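/- Let $H_3$ be the three-dimensional Heisenberg group, that is, the Lie group of upper unitriangular real $3\times 3$ matrices. A left-invariant pseudo-Riemannian metric of signature $(p,q)$ on a Lie group $G$ is a smooth field $g$ of nondegenerate symmetric bilinear forms on the tangent spaces $T_aG$, each having $p$ positive and $q$ negative eigenvalues, such that every left translation of $G$ is an isometry. Two such metrics $g_1, g_2$ on $G$ are called equivalent up to scaling and automorphisms if there exist $c>0$ and a Lie group automorphism $\varphi : G\to G$ such that $$g_1(x,y)_a = c\, g_2(d\varphi_a(x), d\varphi_a(y))_{\varphi(a)} \qquad \text{for all } a\in G \text{ and } x,y\in T_aG.$$ **Theorem.** Let $p,q\ge 1$ be integers with $p+q\ge 4$. The number of left-invariant pseudo-Riemannian metrics of signature $(p,q)$ on $H_3\times\mathbb{R}^{p+q-3}$ up to scaling and automorphisms (that is, the number of equivalence classes) is 1. $21$ if $p,q\ge 3$; 2. $15$ if $p\ge 3$ and $q=2$; 3. $6$ if $p\ge 3$ and $q=1$; 4. $10$ if $p=q=2$. -/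

import Mathlib

open scoped Manifold ContDiff
open Bundle

/-! ### Left-invariant pseudo-Riemannian metrics on a Lie group -/

section General

variable {E : Type*} [NormedAddCommGroup E] [NormedSpace ℝ E]
  {H : Type*} [TopologicalSpace H] (I : ModelWithCorners ℝ E H)
  (G : Type*) [TopologicalSpace G] [ChartedSpace H G] [Group G]

/-- A left-invariant pseudo-Riemannian metric of signature `(p, q)` on the Lie group `G`: a smooth
section of nondegenerate symmetric bilinear forms on the tangent spaces of `G`, each of which has
signature `(p, q)` (`p` positive and `q` negative eigenvalues), such that every left translation
of `G` is an isometry. -/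
structure LeftInvariantMetric [LieGroup I ∞ G] (p q : ℕ) where
  /-- The inner product on each tangent space. -/
  inner (a : G) : TangentSpace I a →L[ℝ] TangentSpace I a →L[ℝ] ℝ
  symm (a : G) (x y : TangentSpace I a) : inner a x y = inner a y x
  nondegenerate (a : G) (x : TangentSpace I a) (h : ∀ y, inner a x y = 0) : x = 0
  sigPos_eq (a : G) :
    sigPos (LinearMap.BilinMap.toQuadraticMap (inner a).toLinearMap₁₂) = p
  sigNeg_eq (a : G) :
    sigNeg (LinearMap.BilinMap.toQuadraticMap (inner a).toLinearMap₁₂) = q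
  contMDiff : ContMDiff I (I.prod 𝓘(ℝ, E →L[ℝ] E →L[ℝ] ℝ)) ∞
    (fun a ↦ TotalSpace.mk' (E →L[ℝ] E →L[ℝ] ℝ) (E := fun a : G ↦
      TangentSpace I a →L[ℝ] TangentSpace I a →L[ℝ] ℝ) a (inner a))
  left_invariant (b a : G) (x y : TangentSpace I a) :
    inner (b * a) (mfderiv I I (fun c ↦ b * c) a x) (mfderiv I I (fun c ↦ b * c) a y) =
      inner a x y

variable {I G}

/-- Two left-invariant metrics `g₁`, `g₂` on `G` are equivalent up to scaling and automorphisms if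
there are `c > 0` and a Lie group automorphism `φ` of `G` with
`g₁(x, y)_a = c g₂(dφ_a x, dφ_a y)_{φ(a)}` for all `a` in `G` and all tangent vectors `x`, `y`
at `a`. -/
def LeftInvariantMetric.Equivalent [LieGroup I ∞ G] {p q : ℕ}
    (g₁ g₂ : LeftInvariantMetric I G p q) : Prop :=
  ∃ c : ℝ, 0 < c ∧ ∃ φ : G ≃* G, ContMDiff I I ∞ φ ∧ ContMDiff I I ∞ φ.symm ∧
    ∀ (a : G) (x y : TangentSpace I a),
      g₁.inner a x y = c * g₂.inner (φ a) (mfderiv I I φ a x) (mfderiv I I φ a y)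

theorem LeftInvariantMetric.equivalent_refl [LieGroup I ∞ G] {p q : ℕ}
    (g : LeftInvariantMetric I G p q) : g.Equivalent g := by
  refine ⟨1, one_pos, MulEquiv.refl G, contMDiff_id, contMDiff_id, fun a x y ↦ ?_⟩
  have h : mfderiv I I (MulEquiv.refl G) a = ContinuousLinearMap.id ℝ (TangentSpace I a) :=
    mfderiv_id
  rw [h, one_mul]
  rfl

theorem LeftInvariantMetric.Equivalent.symm [LieGroup I ∞ G] {p q : ℕ}
    {g₁ g₂ : LeftInvariantMetric I G p q} (h : g₁.Equivalent g₂) : g₂.Equivalent g₁ := by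
  obtain ⟨c, hc, φ, hφ, hφ', h⟩ := h
  refine ⟨c⁻¹, inv_pos.2 hc, φ.symm, hφ', hφ, fun a x y ↦ ?_⟩
  have key : ∀ x : TangentSpace I a,
      (mfderiv I I φ (φ.symm a) (mfderiv I I φ.symm a x) : E) = x := by
    intro x
    have h1 := mfderiv_comp_apply (I := I) (I' := I) (I'' := I) a
      (hφ.mdifferentiable (by simp) (φ.symm a)) (hφ'.mdifferentiable (by simp) a) x
    have h2 : (φ ∘ φ.symm : G → G) = id := by ext; simp
    rw [h2, mfderiv_id] at h1
    exact h1.symm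
  have aux : ∀ (b : G), b = a → ∀ (u v : E), g₂.inner a u v = g₂.inner b u v := by
    rintro b rfl u v; rfl
  rw [h (φ.symm a), inv_mul_cancel_left₀ hc.ne', aux _ (φ.apply_symm_apply a) x y]
  exact (congrArg₂ (fun u v : E ↦ g₂.inner (φ (φ.symm a)) u v) (key x) (key y)).symm

theorem LeftInvariantMetric.Equivalent.trans [LieGroup I ∞ G] {p q : ℕ}
    {g₁ g₂ g₃ : LeftInvariantMetric I G p q} (h : g₁.Equivalent g₂) (h' : g₂.Equivalent g₃) :
    g₁.Equivalent g₃ := by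
  obtain ⟨c, hc, φ, hφ, hφ', h⟩ := h
  obtain ⟨d, hd, ψ, hψ, hψ', h'⟩ := h'
  refine ⟨c * d, mul_pos hc hd, φ.trans ψ, hψ.comp hφ, hφ'.comp hψ', fun a x y ↦ ?_⟩
  have key : ∀ x : TangentSpace I a, mfderiv I I (φ.trans ψ) a x =
      mfderiv I I ψ (φ a) (mfderiv I I φ a x) := fun x ↦
    mfderiv_comp_apply (I := I) (I' := I) (I'' := I) a
      (hψ.mdifferentiable (by simp) (φ a)) (hφ.mdifferentiable (by simp) a) x
  rw [h, h', key, key, mul_assoc]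
  rfl

/-- Equivalence up to scaling and automorphisms, as a setoid on the left-invariant metrics of
signature `(p, q)`. -/
def LeftInvariantMetric.setoid [LieGroup I ∞ G] {p q : ℕ} :
    Setoid (LeftInvariantMetric I G p q) where
  r := LeftInvariantMetric.Equivalent
  iseqv := ⟨LeftInvariantMetric.equivalent_refl, fun h ↦ h.symm, fun h h' ↦ h.trans h'⟩

end General

/-! ### The Lie groups `H₃` and `ℝ^m` -/

/-- The three-dimensional Heisenberg group `H₃`, as `ℝ³` in exponential coordinates. -/
def Heisenberg : Type := ℝ × ℝ × ℝ

namespace Heisenberg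

instance : TopologicalSpace Heisenberg := inferInstanceAs (TopologicalSpace (ℝ × ℝ × ℝ))

instance : ChartedSpace (ℝ × ℝ × ℝ) Heisenberg :=
  inferInstanceAs (ChartedSpace (ℝ × ℝ × ℝ) (ℝ × ℝ × ℝ))

/-- The group law `(x, y, z) (x', y', z') = (x + x', y + y', z + z' + (x y' - y x') / 2)`. -/
noncomputable instance : Mul Heisenberg :=
  ⟨fun a b ↦ (a.1 + b.1, a.2.1 + b.2.1, a.2.2 + b.2.2 + (a.1 * b.2.1 - a.2.1 * b.1) / 2)⟩

instance : One Heisenberg := ⟨((0 : ℝ), (0 : ℝ), (0 : ℝ))⟩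

noncomputable instance : Inv Heisenberg := ⟨fun a ↦ (-a.1, -a.2.1, -a.2.2)⟩

theorem mul_def (a b : Heisenberg) : a * b =
    (a.1 + b.1, a.2.1 + b.2.1, a.2.2 + b.2.2 + (a.1 * b.2.1 - a.2.1 * b.1) / 2) := rfl

theorem one_def : (1 : Heisenberg) = ((0 : ℝ), (0 : ℝ), (0 : ℝ)) := rfl

theorem inv_def (a : Heisenberg) : a⁻¹ = (-a.1, -a.2.1, -a.2.2) := rfl

noncomputable instance : Group Heisenberg :=
  Group.ofLeftAxioms
    (fun a b c ↦ by
      rw [mul_def (a * b), mul_def a (b * c), mul_def a b, mul_def b c]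
      refine Prod.ext ?_ (Prod.ext ?_ ?_) <;> dsimp only <;> ring)
    (fun a ↦ by
      rw [mul_def, one_def]
      refine Prod.ext ?_ (Prod.ext ?_ ?_) <;> simp)
    (fun a ↦ by
      rw [mul_def, one_def, inv_def]
      refine Prod.ext ?_ (Prod.ext ?_ ?_) <;> simp [mul_comm])

/-- The identification of `H₃` with a group of real `3 × 3` matrices. -/
noncomputable def toMatrix : Heisenberg →* Matrix (Fin 3) (Fin 3) ℝ where
  toFun a := !![1, a.1, a.2.2 + a.1 * a.2.1 / 2; 0, 1, a.2.1; 0, 0, 1]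
  map_one' := by
    rw [one_def]
    ext i j
    fin_cases i <;> fin_cases j <;> simp
  map_mul' a b := by
    rw [mul_def]
    ext i j
    fin_cases i <;> fin_cases j <;> simp [Matrix.mul_apply, Fin.sum_univ_three] <;> ring

theorem toMatrix_injective : Function.Injective toMatrix := by
  intro a b h
  have h1 : a.1 = b.1 := congrFun (congrFun h 0) 1
  have h2 : a.2.1 = b.2.1 := congrFun (congrFun h 1) 2
  have h3 : a.2.2 + a.1 * a.2.1 / 2 = b.2.2 + b.1 * b.2.1 / 2 := congrFun (congrFun h 0) 2
  rw [h1, h2] at h3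
  exact Prod.ext h1 (Prod.ext h2 (add_right_cancel h3))

/-- `H₃` is the group of upper unitriangular real `3 × 3` matrices. -/
theorem range_toMatrix : Set.range toMatrix =
    {M | (∀ i, M i i = 1) ∧ ∀ i j, j < i → M i j = 0} := by
  ext M
  constructor
  · rintro ⟨a, rfl⟩
    constructor
    · intro i
      fin_cases i <;> simp [toMatrix]
    · intro i j h
      fin_cases i <;> fin_cases j <;> first | (exact absurd h (by decide)) | simp [toMatrix]
  · rintro ⟨h1, h2⟩
    refine ⟨(M 0 1, M 1 2, M 0 2 - M 0 1 * M 1 2 / 2), ?_⟩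
    have h10 := h2 1 0 (by decide)
    have h20 := h2 2 0 (by decide)
    have h21 := h2 2 1 (by decide)
    ext i j
    fin_cases i <;> fin_cases j <;> simp [toMatrix, h1, h10, h20, h21]

instance : LieGroup 𝓘(ℝ, ℝ × ℝ × ℝ) ∞ Heisenberg where
  __ := instIsManifoldModelSpace (I := 𝓘(ℝ, ℝ × ℝ × ℝ)) (n := ∞)
  contMDiff_mul := by
    have h : ContDiff ℝ ∞ (fun u : (ℝ × ℝ × ℝ) × (ℝ × ℝ × ℝ) ↦
        (u.1.1 + u.2.1, u.1.2.1 + u.2.2.1,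
          u.1.2.2 + u.2.2.2 + (u.1.1 * u.2.2.1 - u.1.2.1 * u.2.1) / 2)) := by fun_prop
    have h' := h.contMDiff
    rw [modelWithCornersSelf_prod, ← chartedSpaceSelf_prod] at h'
    exact h'
  contMDiff_inv := by
    have h : ContDiff ℝ ∞ (fun u : ℝ × ℝ × ℝ ↦ (-u.1, -u.2.1, -u.2.2)) := by fun_prop
    exact h.contMDiff

end Heisenberg

/-- The abelian group `ℝ^m`, written multiplicatively. -/
abbrev VectorGroup (m : ℕ) : Type := Multiplicative (Fin m → ℝ)

instance (m : ℕ) : ChartedSpace (Fin m → ℝ) (VectorGroup m) :=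
  inferInstanceAs (ChartedSpace (Fin m → ℝ) (Fin m → ℝ))

instance (m : ℕ) : LieGroup 𝓘(ℝ, Fin m → ℝ) ∞ (VectorGroup m) where
  __ := instIsManifoldModelSpace (I := 𝓘(ℝ, Fin m → ℝ)) (n := ∞)
  contMDiff_mul := contMDiff_add 𝓘(ℝ, Fin m → ℝ) ∞ (G := Fin m → ℝ)
  contMDiff_inv := contMDiff_neg 𝓘(ℝ, Fin m → ℝ) ∞ (G := Fin m → ℝ)

/-- The model with corners of the product manifold `H₃ × ℝ^m`. -/
noncomputable abbrev heisenbergModel (m : ℕ) :=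
  (𝓘(ℝ, ℝ × ℝ × ℝ)).prod 𝓘(ℝ, Fin m → ℝ)

/-- The number of left-invariant pseudo-Riemannian metrics of signature `(p, q)` on the Lie group
`H₃ × ℝ^(p + q - 3)` up to scaling and automorphisms. -/
noncomputable def numLeftInvariantMetrics (p q : ℕ) : ℕ :=
  Nat.card (Quotient (LeftInvariantMetric.setoid
    (I := heisenbergModel (p + q - 3)) (G := Heisenberg × VectorGroup (p + q - 3))
    (p := p) (q := q)))

/-!
In exponential coordinates the group `H₃ × ℝ^m` is the vector space `V = ℝ³ × ℝ^m` with the law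
`a * b = a + b + (ω(a, b) / 2) e_z`, so a left-invariant metric of signature `(p, q)` is the same as
a scalar product of signature `(p, q)` on `V` (`inner_eq`, `exists_form_eq`). The differential of an
automorphism preserves the derived algebra `D = ℝ e_z` and the center `Z`, which has codimension
two. Conversely, let `B` be any linear automorphism preserving `D` and `Z`, acting on `D` by `d` and
on `V / Z` with determinant `δ`. Then `(d / δ) B` is an automorphism of the Lie algebra, and of the
group. As metrics are considered up to scaling, their classes are the orbits of the stabilizer of the
flag `D ⊂ Z` on the scalar products (`exists_linearEquiv_of_equivalent`,
`equivalent_of_linearEquiv`).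

These orbits are found by linear algebra. Choose orthogonal vectors of length `1`, `-1` or `0` that
span the plane `Zᗮ` and the line `D`, which is orthogonal to `Zᗮ`. If `D ⊄ Zᗮ`, the invariants are the
two signs of `Zᗮ`, up to order, and the sign of `D`: there are `6 * 3` cases. If `D ⊂ Zᗮ`, then one of
the signs of `Zᗮ` is `0`, being that of `D`, and the other is the only invariant: there are `3` cases.
The signs are well defined (`HasFlagType.unique`) and by Witt's extension theorem
(`exists_isometry_of_gram_eq`) they determine the orbit (`exists_flag_isometry`). Orthogonal vectors
with given signs exist in signature `(p, q)` if and only if at most `p` of the signs are nonnegative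
and at most `q` are nonpositive (`IsSignDiagonal.card_nonneg_le`, `IsSignDiagonal.card_nonpos_le`,
`exists_isSignDiagonal`). It remains to count the lists of signs with this property.
-/


/-! ### Scalar products and Witt's extension theorem -/

section LinearAlgebra

open Module

variable {V : Type*} [AddCommGroup V] [Module ℝ V] {p q : ℕ} {b b' : LinearMap.BilinForm ℝ V}

/-- `b` is a scalar product of signature `(p, q)`: a nondegenerate symmetric bilinear form with
`p` positive and `q` negative directions on a space of dimension `p + q`. -/
structure IsScalarProduct (p q : ℕ) (b : LinearMap.BilinForm ℝ V) : Prop where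
  symm (x y : V) : b x y = b y x
  eq_zero (x : V) (h : ∀ y, b x y = 0) : x = 0
  sigPos_eq : sigPos (LinearMap.BilinMap.toQuadraticMap b) = p
  sigNeg_eq : sigNeg (LinearMap.BilinMap.toQuadraticMap b) = q
  finrank_eq : finrank ℝ V = p + q

namespace IsScalarProduct

theorem nondegenerate (hb : IsScalarProduct p q b) : b.Nondegenerate :=
  ⟨fun x h ↦ hb.eq_zero x h, fun x h ↦ hb.eq_zero x fun y ↦ (hb.symm x y).trans (h y)⟩

theorem isRefl (hb : IsScalarProduct p q b) : b.IsRefl :=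
  fun x y h ↦ (hb.symm y x).trans h

/-- Scalar products can be transported along linear equivalences. -/
theorem comp {V' : Type*} [AddCommGroup V'] [Module ℝ V'] {b : LinearMap.BilinForm ℝ V'}
    (hb : IsScalarProduct p q b) (e : V ≃ₗ[ℝ] V') {c : LinearMap.BilinForm ℝ V}
    (h : ∀ x y, c x y = b (e x) (e y)) : IsScalarProduct p q c := by
  have h' : (LinearMap.BilinMap.toQuadraticMap c).Equivalent
      (LinearMap.BilinMap.toQuadraticMap b) := ⟨⟨e, fun x ↦ (h x x).symm⟩⟩
  refine ⟨fun x y ↦ ?_, fun x hx ↦ ?_, ?_, ?_, ?_⟩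
  · rw [h, h, hb.symm]
  · refine e.injective ?_
    rw [map_zero]
    refine hb.eq_zero _ fun y ↦ ?_
    have := hx (e.symm y)
    rwa [h, e.apply_symm_apply] at this
  · rw [h'.sigPos_eq, hb.sigPos_eq]
  · rw [h'.sigNeg_eq, hb.sigNeg_eq]
  · rw [e.finrank_eq, hb.finrank_eq]

variable [FiniteDimensional ℝ V]

theorem exists_posDef (hb : IsScalarProduct p q b) :
    ∃ P : Submodule ℝ V, finrank ℝ P = p ∧ ∀ x ∈ P, x ≠ 0 → 0 < b x x := by
  obtain ⟨P, h1, h2⟩ := exists_finrank_eq_sigPos_and_posDef (LinearMap.BilinMap.toQuadraticMap b)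
  refine ⟨P, h1.trans hb.sigPos_eq, fun x hx h0 ↦ ?_⟩
  exact h2 ⟨x, hx⟩ (by simpa using h0)

theorem exists_negDef (hb : IsScalarProduct p q b) :
    ∃ N : Submodule ℝ V, finrank ℝ N = q ∧ ∀ x ∈ N, x ≠ 0 → b x x < 0 := by
  obtain ⟨P, h1, h2⟩ := exists_finrank_eq_sigNeg_and_negDef (LinearMap.BilinMap.toQuadraticMap b)
  refine ⟨P, h1.trans hb.sigNeg_eq, fun x hx h0 ↦ ?_⟩
  have := h2 ⟨x, hx⟩ (by simpa using h0)
  simpa using this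

/-- A subspace on which `b` is nonnegative meets a maximal negative subspace trivially. -/
theorem finrank_le_of_nonneg (hb : IsScalarProduct p q b) {U : Submodule ℝ V}
    (hU : ∀ x ∈ U, 0 ≤ b x x) : finrank ℝ U ≤ p := by
  have h := QuadraticForm.sigPos_add_finrank_le_of_nonpos
    (Q := -LinearMap.BilinMap.toQuadraticMap b) (V := U) (fun x hx ↦ by simpa using hU x hx)
  rw [sigPos_neg, hb.sigNeg_eq, hb.finrank_eq] at h
  omega

theorem finrank_le_of_nonpos (hb : IsScalarProduct p q b) {U : Submodule ℝ V}
    (hU : ∀ x ∈ U, b x x ≤ 0) : finrank ℝ U ≤ q := by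
  have h := QuadraticForm.sigPos_add_finrank_le_of_nonpos
    (Q := LinearMap.BilinMap.toQuadraticMap b) (V := U) (fun x hx ↦ by simpa using hU x hx)
  rw [hb.sigPos_eq, hb.finrank_eq] at h
  omega

/-- The values `b v (u i)` on a linearly independent family can be prescribed. -/
theorem exists_forall_eq (hb : IsScalarProduct p q b) {ι : Type*} {u : ι → V}
    (hu : LinearIndependent ℝ u) (c : ι → ℝ) : ∃ v, ∀ i, b v (u i) = c i := by
  obtain ⟨f, hf⟩ := LinearMap.exists_extend ((Basis.span hu).constr ℝ c)
  refine ⟨(b.toDual hb.nondegenerate).symm f, fun i ↦ ?_⟩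
  rw [← LinearMap.BilinForm.toDual_def hb.nondegenerate, LinearEquiv.apply_symm_apply]
  have h := LinearMap.congr_fun hf (Basis.span hu i)
  rw [Basis.constr_basis] at h
  rw [← h, LinearMap.comp_apply, Submodule.subtype_apply, Basis.span_apply]

end IsScalarProduct

theorem notMem_span_of_orthogonal {ι : Type*} {u : ι → V} {v : V} {r : V} (hr : ∀ i, b r (u i) = 0)
    (hv : b r v ≠ 0) : v ∉ Submodule.span ℝ (Set.range u) := by
  intro h
  refine hv ?_
  have : Submodule.span ℝ (Set.range u) ≤ LinearMap.ker (b r) := by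
    rw [Submodule.span_le]
    rintro _ ⟨i, rfl⟩
    exact hr i
  exact this h

section Witt

variable [FiniteDimensional ℝ V] {ι : Type*} [Fintype ι] {u u' : ι → V}

/-- If the Gram matrix of `u` is nonsingular and `u` does not span, then it is impossible that `b`
is nonnegative on the orthogonal complement of `u` and `b'` is nonpositive on that of `u'`. The
projection to the span of `u` would embed a maximal negative subspace of `b` and, after
identifying the two spans, a maximal positive subspace of `b'` in general position into it. -/
theorem exists_orthogonal_neg_or_pos (hb : IsScalarProduct p q b) (hb' : IsScalarProduct p q b')
    (hG : ∀ i j, b (u i) (u j) = b' (u' i) (u' j))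
    (hns : ∀ c : ι → ℝ, (∀ j, ∑ i, c i * b (u i) (u j) = 0) → c = 0)
    (hcard : Fintype.card ι < finrank ℝ V) :
    (∃ v, (∀ i, b v (u i) = 0) ∧ b v v < 0) ∨ ∃ v, (∀ i, b' v (u' i) = 0) ∧ 0 < b' v v := by
  by_contra! hcon
  obtain ⟨hpos, hneg⟩ := hcon
  obtain ⟨N, hN, hNb⟩ := hb.exists_negDef
  obtain ⟨P, hP, hPb⟩ := hb'.exists_posDef
  -- `x ∈ N` and `y ∈ P` with the same products with the two families
  let T : N × P →ₗ[ℝ] ι → ℝ := LinearMap.pi fun i ↦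
    ((b.flip (u i)).comp N.subtype).coprod (-(b'.flip (u' i)).comp P.subtype)
  have hT : LinearMap.ker T ≠ ⊥ := by
    refine LinearMap.ker_ne_bot_of_finrank_lt ?_
    rw [finrank_prod, hN, hP, finrank_fintype_fun_eq_card, add_comm, ← hb.finrank_eq]
    exact hcard
  obtain ⟨⟨x, y⟩, hxy, hne⟩ := (Submodule.ne_bot_iff _).1 hT
  have hxy' : ∀ j, b x (u j) = b' y (u' j) := fun j ↦ by
    have := congrFun hxy j
    simpa [T, add_neg_eq_zero] using this
  -- the common coefficients of the projections of `x` and `y`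
  let M : (ι → ℝ) →ₗ[ℝ] ι → ℝ := LinearMap.pi fun j ↦
    ∑ i, b (u i) (u j) • LinearMap.proj (R := ℝ) (φ := fun _ : ι ↦ ℝ) i
  have hM : ∀ c j, M c j = ∑ i, c i * b (u i) (u j) := fun c j ↦ by
    simp [M, mul_comm]
  have hMs : Function.Surjective M := by
    refine LinearMap.surjective_of_injective ?_
    rw [← LinearMap.ker_eq_bot, LinearMap.ker_eq_bot']
    intro c hc
    exact hns c fun j ↦ by rw [← hM, hc, Pi.zero_apply]
  obtain ⟨c, hc⟩ := hMs fun j ↦ b x (u j)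
  have hc1 : ∀ j, ∑ i, c i * b (u i) (u j) = b x (u j) := fun j ↦ by rw [← hM, hc]
  have h1 : ∀ j, b (x - ∑ i, c i • u i) (u j) = 0 := fun j ↦ by
    simp [hc1]
  have h2 : ∀ j, b' (y - ∑ i, c i • u' i) (u' j) = 0 := fun j ↦ by
    simp [← hG, hc1, hxy']
  have key : ∀ (β : LinearMap.BilinForm ℝ V) (w : ι → V) (z : V),
      (∀ x y, β x y = β y x) → (∀ j, β (z - ∑ i, c i • w i) (w j) = 0) →
      β z z = β (z - ∑ i, c i • w i) (z - ∑ i, c i • w i) + ∑ j, c j * ∑ i, c i * β (w i) (w j) := by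
    intro β w z hs h
    have e1 : β (z - ∑ i, c i • w i) (∑ i, c i • w i) = 0 := by
      simp only [map_sum, map_smul, h, smul_zero, Finset.sum_const_zero]
    have e2 : β (∑ i, c i • w i) (∑ i, c i • w i) = ∑ j, c j * ∑ i, c i * β (w i) (w j) := by
      simp [map_sum]
    have e3 := hs (z - ∑ i, c i • w i) (∑ i, c i • w i)
    have e4 : z = (z - ∑ i, c i • w i) + ∑ i, c i • w i := by abel
    conv_lhs => rw [e4]
    simp only [map_add, LinearMap.add_apply]
    rw [e1, e2, ← e3, e1]
    ring
  have k1 := key b u x hb.symm h1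
  have k2 := key b' u' y hb'.symm h2
  simp only [← hG] at k2
  have i1 := hpos _ h1
  have i2 := hneg _ h2
  have hx : (x : V) = 0 := by
    by_contra h0
    have := hNb x x.2 h0
    by_cases hy : (y : V) = 0
    · have : b' y y = 0 := by rw [hy, map_zero]
      linarith
    · have := hPb y y.2 hy
      linarith
  have hy : (y : V) = 0 := by
    by_contra h0
    have := hPb y y.2 h0
    have : b x x = 0 := by rw [hx, map_zero]
    linarith
  exact hne (Prod.ext (Subtype.ext hx) (Subtype.ext hy))

/-- Two linearly independent families with the same Gram matrix that do not span can be extended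
by one vector each, keeping both properties. -/
theorem exists_extension_of_gram_eq (hb : IsScalarProduct p q b) (hb' : IsScalarProduct p q b')
    (hu : LinearIndependent ℝ u) (hu' : LinearIndependent ℝ u')
    (hG : ∀ i j, b (u i) (u j) = b' (u' i) (u' j)) (hcard : Fintype.card ι < finrank ℝ V) :
    ∃ v v', v ∉ Submodule.span ℝ (Set.range u) ∧ v' ∉ Submodule.span ℝ (Set.range u') ∧
      (∀ i, b v (u i) = b' v' (u' i)) ∧ b v v = b' v' v' := by
  classical
  by_cases hns : ∀ c : ι → ℝ, (∀ j, ∑ i, c i * b (u i) (u j) = 0) → c = 0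
  · -- nonsingular Gram matrix: add orthogonal vectors of the same nonzero length
    have hns' : ∀ c : ι → ℝ, (∀ j, ∑ i, c i * b' (u' i) (u' j) = 0) → c = 0 := by
      simpa only [hG] using hns
    have a1 := exists_orthogonal_neg_or_pos hb hb' hG hns hcard
    have a2 := exists_orthogonal_neg_or_pos hb' hb (fun i j ↦ (hG i j).symm) hns' hcard
    have a3 := exists_orthogonal_neg_or_pos hb hb (fun i j ↦ rfl) hns hcard
    have a4 := exists_orthogonal_neg_or_pos hb' hb' (fun i j ↦ rfl) hns' hcard
    obtain ⟨v, v', hv, hv', hs⟩ : ∃ v v', (∀ i, b v (u i) = 0) ∧ (∀ i, b' v' (u' i) = 0) ∧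
        0 < b v v * b' v' v' := by
      have : ((∃ v, (∀ i, b v (u i) = 0) ∧ 0 < b v v) ∧ ∃ v, (∀ i, b' v (u' i) = 0) ∧ 0 < b' v v) ∨
          ((∃ v, (∀ i, b v (u i) = 0) ∧ b v v < 0) ∧ ∃ v, (∀ i, b' v (u' i) = 0) ∧ b' v v < 0) := by
        exact (by tauto : ∀ P N P' N' : Prop, N ∨ P' → N' ∨ P → N ∨ P → N' ∨ P' →
          (P ∧ P') ∨ (N ∧ N')) _ _ _ _ a1 a2 a3 a4
      obtain ⟨⟨v, h1, h2⟩, v', h3, h4⟩ | ⟨⟨v, h1, h2⟩, v', h3, h4⟩ := this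
      · exact ⟨v, v', h1, h3, mul_pos h2 h4⟩
      · exact ⟨v, v', h1, h3, mul_pos_of_neg_of_neg h2 h4⟩
    have hv0 : b v v ≠ 0 := left_ne_zero_of_mul hs.ne'
    have hv0' : b' v' v' ≠ 0 := right_ne_zero_of_mul hs.ne'
    have hr : 0 < b v v / b' v' v' := by
      rw [div_eq_mul_inv]
      have := div_pos hs (mul_self_pos.2 hv0')
      field_simp at this ⊢
      exact this
    have hsq := Real.mul_self_sqrt hr.le
    have hl : b' (√(b v v / b' v' v') • v') (√(b v v / b' v' v') • v') = b v v := by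
      simp only [map_smul, LinearMap.smul_apply, smul_eq_mul]
      rw [← mul_assoc, hsq, div_mul_cancel₀ _ hv0']
    refine ⟨v, √(b v v / b' v' v') • v', notMem_span_of_orthogonal hv hv0,
      notMem_span_of_orthogonal (b := b') (r := √(b v v / b' v' v') • v') (fun i ↦ ?_)
        (by rwa [hl]), fun i ↦ ?_, hl.symm⟩
    · simp [hv']
    · simp [hv, hv']
  · -- singular Gram matrix: add partners of a vector in the radical, making a hyperbolic pair
    push Not at hns
    obtain ⟨c, hc, hc0⟩ := hns
    obtain ⟨i₀, hi₀⟩ : ∃ i, c i ≠ 0 := by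
      by_contra! h
      exact hc0 (funext h)
    have key : ∀ (β : LinearMap.BilinForm ℝ V) (w : ι → V), IsScalarProduct p q β →
        LinearIndependent ℝ w → (∀ j, ∑ i, c i * β (w i) (w j) = 0) →
        ∃ v, v ∉ Submodule.span ℝ (Set.range w) ∧
          (∀ i, β v (w i) = if i = i₀ then 1 else 0) ∧ β v v = 0 := by
      intro β w hβ hw h
      obtain ⟨v, hv⟩ := hβ.exists_forall_eq hw fun i ↦ if i = i₀ then 1 else 0
      have hr : ∀ j, β (∑ i, c i • w i) (w j) = 0 := fun j ↦ by
        simpa [map_sum] using h j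
      have hvr : β v (∑ i, c i • w i) = c i₀ := by
        simp [map_sum, hv]
      have hrr : β (∑ i, c i • w i) (∑ i, c i • w i) = 0 := by
        rw [map_sum]
        simp only [map_smul, hr, smul_zero, Finset.sum_const_zero]
      have hrv := (hβ.symm (∑ i, c i • w i) v).trans hvr
      generalize (∑ i, c i • w i) = r at *
      refine ⟨v - (β v v / (2 * c i₀)) • r, notMem_span_of_orthogonal hr ?_, fun i ↦ ?_, ?_⟩
      · simpa [hrr, hrv] using hi₀
      · simp [hr, hv]
      · simp only [map_sub, LinearMap.sub_apply, map_smul, LinearMap.smul_apply, hvr, hrv, hrr,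
          smul_eq_mul]
        field_simp
        ring
    obtain ⟨v, h1, h2, h3⟩ := key b u hb hu hc
    obtain ⟨v', h1', h2', h3'⟩ := key b' u' hb' hu' (by simpa only [hG] using hc)
    exact ⟨v, v', h1, h1', fun i ↦ by rw [h2, h2'], by rw [h3, h3']⟩

end Witt

/-- **Witt's extension theorem** for families of vectors: linearly independent families with the
same Gram matrix with respect to two scalar products of the same signature correspond under an
isometry. -/
theorem exists_isometry_of_gram_eq [FiniteDimensional ℝ V] (hb : IsScalarProduct p q b)
    (hb' : IsScalarProduct p q b') {ι : Type*} [Fintype ι] {u u' : ι → V}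
    (hu : LinearIndependent ℝ u) (hu' : LinearIndependent ℝ u')
    (hG : ∀ i j, b (u i) (u j) = b' (u' i) (u' j)) :
    ∃ B : V ≃ₗ[ℝ] V, (∀ i, B (u i) = u' i) ∧ ∀ x y, b x y = b' (B x) (B y) := by
  obtain ⟨k, hk⟩ : ∃ k, k + Fintype.card ι = finrank ℝ V :=
    ⟨_, Nat.sub_add_cancel hu.fintype_card_le_finrank⟩
  induction k generalizing ι with
  | zero =>
    rw [zero_add] at hk
    cases isEmpty_or_nonempty ι with
    | inl h =>
      rw [Fintype.card_eq_zero] at hk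
      have := finrank_zero_iff.1 hk.symm
      exact ⟨.refl ℝ V, fun i ↦ isEmptyElim i, fun x y ↦ by
        rw [Subsingleton.elim x 0, map_zero, map_zero, map_zero, LinearMap.zero_apply,
          LinearMap.zero_apply]⟩
    | inr h =>
      let B := (basisOfLinearIndependentOfCardEqFinrank hu hk).equiv
        (basisOfLinearIndependentOfCardEqFinrank hu' hk) (Equiv.refl ι)
      have hB : ∀ i, B (u i) = u' i := fun i ↦ by
        have := (basisOfLinearIndependentOfCardEqFinrank hu hk).equiv_apply i
          (basisOfLinearIndependentOfCardEqFinrank hu' hk) (Equiv.refl ι)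
        simpa using this
      refine ⟨B, hB, fun x y ↦ ?_⟩
      have : b = b'.compl₁₂ B.toLinearMap B.toLinearMap := by
        refine (basisOfLinearIndependentOfCardEqFinrank hu hk).ext fun i ↦
          (basisOfLinearIndependentOfCardEqFinrank hu hk).ext fun j ↦ ?_
        simp [hB, hG]
      rw [this]
      rfl
  | succ k ih =>
    obtain ⟨v, v', hv, hv', h1, h2⟩ := exists_extension_of_gram_eq hb hb' hu hu' hG (by omega)
    obtain ⟨B, hB1, hB2⟩ := ih (ι := Option ι) (u := fun o ↦ o.elim v u) (u' := fun o ↦ o.elim v' u')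
      (linearIndependent_option.2 ⟨hu, hv⟩) (linearIndependent_option.2 ⟨hu', hv'⟩)
      (by
        rintro (_ | i) (_ | j)
        · exact h2
        · exact h1 j
        · show b (u i) v = b' (u' i) v'
          rw [hb.symm, h1, hb'.symm]
        · exact hG i j)
      (by rw [Fintype.card_option]; omega)
    exact ⟨B, fun i ↦ hB1 (some i), hB2⟩

end LinearAlgebra

/-! ### Orthogonal families of vectors of length `±1` or `0` -/

section Flags

open Module

variable {V : Type*} [AddCommGroup V] [Module ℝ V] {p q : ℕ} {b b' : LinearMap.BilinForm ℝ V}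

theorem SignType.sign_coe_real (s : SignType) : SignType.sign (s : ℝ) = s := by
  cases s <;> simp

/-- `u` is a linearly independent family whose Gram matrix is diagonal with entries `s i`. -/
structure IsSignDiagonal (b : LinearMap.BilinForm ℝ V) {ι : Type*} [DecidableEq ι]
    (s : ι → SignType) (u : ι → V) : Prop where
  linearIndependent : LinearIndependent ℝ u
  gram (i j : ι) : b (u i) (u j) = if i = j then (s i : ℝ) else 0

namespace IsSignDiagonal

variable {ι : Type*} [Fintype ι] [DecidableEq ι] {s : ι → SignType} {u : ι → V}

omit [Fintype ι] in
theorem map {V' : Type*} [AddCommGroup V'] [Module ℝ V'] {b' : LinearMap.BilinForm ℝ V'}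
    (hu : IsSignDiagonal b s u) (B : V ≃ₗ[ℝ] V') (h : ∀ x y, b x y = b' (B x) (B y)) :
    IsSignDiagonal b' s (B ∘ u) :=
  ⟨hu.linearIndependent.map' _ B.ker, fun i j ↦ by rw [← hu.gram]; exact (h _ _).symm⟩

theorem apply_sum_self (hu : IsSignDiagonal b s u) (c : ι → ℝ) :
    b (∑ i, c i • u i) (∑ i, c i • u i) = ∑ i, s i * (c i * c i) := by
  simp only [map_sum, LinearMap.sum_apply, map_smul, LinearMap.smul_apply, hu.gram, smul_eq_mul]
  simp [mul_comm, mul_assoc]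

theorem card_nonneg_le [FiniteDimensional ℝ V] (hb : IsScalarProduct p q b)
    (hu : IsSignDiagonal b s u) : Fintype.card {i // 0 ≤ s i} ≤ p := by
  have hli := hu.linearIndependent.comp (Subtype.val : {i // 0 ≤ s i} → ι) Subtype.val_injective
  have hd : IsSignDiagonal b (fun i : {i // 0 ≤ s i} ↦ s i) (u ∘ Subtype.val) :=
    ⟨hli, fun i j ↦ by simp [hu.gram, Subtype.ext_iff]⟩
  rw [← finrank_span_eq_card hli]
  refine hb.finrank_le_of_nonneg fun x hx ↦ ?_
  obtain ⟨c, rfl⟩ := (Submodule.mem_span_range_iff_exists_fun ℝ).1 hx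
  rw [hd.apply_sum_self]
  refine Finset.sum_nonneg fun i _ ↦ mul_nonneg ?_ (mul_self_nonneg _)
  obtain ⟨i, hi⟩ := i
  rw [← sign_nonneg_iff, SignType.sign_coe_real]
  exact hi

theorem card_nonpos_le [FiniteDimensional ℝ V] (hb : IsScalarProduct p q b)
    (hu : IsSignDiagonal b s u) : Fintype.card {i // s i ≤ 0} ≤ q := by
  have hli := hu.linearIndependent.comp (Subtype.val : {i // s i ≤ 0} → ι) Subtype.val_injective
  have hd : IsSignDiagonal b (fun i : {i // s i ≤ 0} ↦ s i) (u ∘ Subtype.val) :=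
    ⟨hli, fun i j ↦ by simp [hu.gram, Subtype.ext_iff]⟩
  rw [← finrank_span_eq_card hli]
  refine hb.finrank_le_of_nonpos fun x hx ↦ ?_
  obtain ⟨c, rfl⟩ := (Submodule.mem_span_range_iff_exists_fun ℝ).1 hx
  rw [hd.apply_sum_self]
  refine Finset.sum_nonpos fun i _ ↦ mul_nonpos_of_nonpos_of_nonneg ?_ (mul_self_nonneg _)
  obtain ⟨i, hi⟩ := i
  rw [← sign_nonpos_iff, SignType.sign_coe_real]
  exact hi

end IsSignDiagonal

/-- The standard form of signature `(p, q)`. -/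
def standardForm (p q : ℕ) : LinearMap.BilinForm ℝ (Fin p ⊕ Fin q → ℝ) :=
  LinearMap.mk₂ ℝ (fun x y ↦ ∑ i, Sum.elim (fun _ ↦ 1) (fun _ ↦ -1) i * (x i * y i))
    (fun x x' y ↦ by simp only [Pi.add_apply, add_mul, mul_add, Finset.sum_add_distrib])
    (fun c x y ↦ by
      simp only [Pi.smul_apply, smul_eq_mul, Finset.mul_sum]
      exact Finset.sum_congr rfl fun i _ ↦ by ring)
    (fun x y y' ↦ by simp only [Pi.add_apply, mul_add, Finset.sum_add_distrib])
    (fun c x y ↦ by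
      simp only [Pi.smul_apply, smul_eq_mul, Finset.mul_sum]
      exact Finset.sum_congr rfl fun i _ ↦ by ring)

theorem standardForm_apply (x y : Fin p ⊕ Fin q → ℝ) : standardForm p q x y =
    ∑ i, x (.inl i) * y (.inl i) - ∑ j, x (.inr j) * y (.inr j) := by
  simp [standardForm, sub_eq_add_neg]

theorem isScalarProduct_standardForm (p q : ℕ) : IsScalarProduct p q (standardForm p q) := by
  have h : LinearMap.BilinMap.toQuadraticMap (standardForm p q) =
      QuadraticMap.weightedSumSquares ℝ
        (Sum.elim (fun _ ↦ 1) (fun _ ↦ -1) : Fin p ⊕ Fin q → ℝ) := by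
    ext x
    simp [standardForm, QuadraticMap.weightedSumSquares_apply]
  refine ⟨fun x y ↦ ?_, fun x hx ↦ ?_, ?_, ?_, ?_⟩
  · simp only [standardForm_apply, mul_comm]
  · ext i
    have := hx (Pi.single i 1)
    rw [standardForm_apply] at this
    cases i <;> simpa [Pi.single_apply] using this
  · rw [h, QuadraticForm.sigPos_weightedSumSquares]
    have : {i : Fin p ⊕ Fin q | (0 : ℝ) < Sum.elim (fun _ ↦ 1) (fun _ ↦ -1) i} =
        Set.range Sum.inl := by
      ext (i | i) <;> simp
    rw [this, Set.ncard_range_of_injective Sum.inl_injective, Nat.card_fin]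
  · rw [h, QuadraticForm.sigNeg_weightedSumSquares]
    have : {i : Fin p ⊕ Fin q | Sum.elim (fun _ ↦ 1) (fun _ ↦ -1) i < (0 : ℝ)} =
        Set.range Sum.inr := by
      ext (i | i) <;> simp
    rw [this, Set.ncard_range_of_injective Sum.inr_injective, Nat.card_fin]
  · simp

/-- The two necessary conditions of `IsSignDiagonal.card_nonneg_le` and
`IsSignDiagonal.card_nonpos_le` are sufficient for the existence of a family with diagonal Gram
matrix: use a positive basis vector for `1`, a negative one for `-1`, and the sum of both for
`0`. -/
theorem exists_isSignDiagonal {ι : Type*} [Fintype ι] [DecidableEq ι] {s : ι → SignType}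
    (hp : Fintype.card {i // 0 ≤ s i} ≤ p) (hq : Fintype.card {i // s i ≤ 0} ≤ q) :
    ∃ u, IsSignDiagonal (standardForm p q) s u := by
  obtain ⟨σ⟩ : Nonempty ({i // 0 ≤ s i} ↪ Fin p) :=
    Function.Embedding.nonempty_of_card_le (by simpa using hp)
  obtain ⟨τ⟩ : Nonempty ({i // s i ≤ 0} ↪ Fin q) :=
    Function.Embedding.nonempty_of_card_le (by simpa using hq)
  let u : ι → Fin p ⊕ Fin q → ℝ := fun k ↦ Sum.elim
    (fun i ↦ if h : 0 ≤ s k then (if σ ⟨k, h⟩ = i then 1 else 0) else 0)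
    (fun j ↦ if h : s k ≤ 0 then (if τ ⟨k, h⟩ = j then 1 else 0) else 0)
  have hσ : ∀ k l (h : 0 ≤ s k), u l (.inl (σ ⟨k, h⟩)) = if k = l then 1 else 0 := by
    intro k l h
    by_cases hl : 0 ≤ s l
    · simp [u, hl, Subtype.ext_iff, eq_comm]
    · simp only [u, Sum.elim_inl, hl, dite_false]
      rw [if_neg]
      rintro rfl
      exact hl h
  have hτ : ∀ k l (h : s k ≤ 0), u l (.inr (τ ⟨k, h⟩)) = if k = l then 1 else 0 := by
    intro k l h
    by_cases hl : s l ≤ 0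
    · simp [u, hl, Subtype.ext_iff, eq_comm]
    · simp only [u, Sum.elim_inr, hl, dite_false]
      rw [if_neg]
      rintro rfl
      exact hl h
  refine ⟨u, ?_, fun k l ↦ ?_⟩
  · rw [Fintype.linearIndependent_iff]
    intro c hc k
    rcases le_total 0 (s k) with h | h
    · have := congrFun hc (.inl (σ ⟨k, h⟩))
      simpa [Finset.sum_apply, hσ] using this
    · have := congrFun hc (.inr (τ ⟨k, h⟩))
      simpa [Finset.sum_apply, hτ] using this
  · have e1 : ∑ i, u k (.inl i) * u l (.inl i) =
        if 0 ≤ s k then (if k = l then 1 else 0) else 0 := by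
      by_cases h : 0 ≤ s k
      · rw [if_pos h, ← hσ k l h]
        simp [u, h, eq_comm (a := k) (b := l)]
      · simp [u, h]
    have e2 : ∑ i, u k (.inr i) * u l (.inr i) =
        if s k ≤ 0 then (if k = l then 1 else 0) else 0 := by
      by_cases h : s k ≤ 0
      · rw [if_pos h, ← hτ k l h]
        simp [u, h, eq_comm (a := k) (b := l)]
      · simp [u, h]
    rw [standardForm_apply, e1, e2]
    have e3 : ∀ a : SignType, (if 0 ≤ a then (1 : ℝ) else 0) - (if a ≤ 0 then 1 else 0) = a := by
      intro a
      cases a <;> simp [show ¬(0 : SignType) ≤ -1 by decide, show ¬(1 : SignType) ≤ 0 by decide,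
        show (-1 : SignType) ≤ 0 by decide, show (0 : SignType) ≤ 1 by decide]
    by_cases hkl : k = l
    · simp only [hkl, if_true, e3]
    · simp [hkl]

end Flags

/-! ### Relative position of a scalar product and a flag -/

section Flags

open Module

variable {V : Type*} [AddCommGroup V] [Module ℝ V] {p q : ℕ} {b b' : LinearMap.BilinForm ℝ V}

/-- The possible relative positions of a line `D`, a subspace `Z ⊇ D` of codimension two, and a
scalar product. The left summand is for the case `D ⊄ Zᗮ`, and lists the sign of `D` and the signs
of the plane `Zᗮ`. The right summand is for the case `D ⊂ Zᗮ`, where `D` is isotropic and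
orthogonal to `Zᗮ`, so that `Zᗮ` has only one more sign. -/
abbrev FlagType : Type := (SignType × SignType × SignType) ⊕ SignType

/-- The flag `D ⊂ Z` has relative position `t` with respect to `b`, as witnessed by a family with
diagonal Gram matrix that spans `D` and `Zᗮ`. -/
def HasFlagType (b : LinearMap.BilinForm ℝ V) (D Z : Submodule ℝ V) : FlagType → Prop
  | .inl s => ∃ d ∈ D, ∃ v ∈ b.orthogonal Z, ∃ w ∈ b.orthogonal Z,
      IsSignDiagonal b ![s.1, s.2.1, s.2.2] ![d, v, w]
  | .inr s => ∃ d ∈ D, ∃ w ∈ b.orthogonal Z, d ∈ b.orthogonal Z ∧ IsSignDiagonal b ![0, s] ![d, w]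

/-- The relative positions that occur in signature `(p, q)`, with the signs of the plane listed in
increasing order. A sum of `k` orthogonal vectors of length zero needs `k` positive and `k` negative
directions. -/
def FlagType.IsAdmissible (p q : ℕ) : FlagType → Prop
  | .inl s => s.2.1 ≤ s.2.2 ∧ Fintype.card {i // 0 ≤ ![s.1, s.2.1, s.2.2] i} ≤ p ∧
      Fintype.card {i // ![s.1, s.2.1, s.2.2] i ≤ 0} ≤ q
  | .inr s => Fintype.card {i // 0 ≤ ![0, s] i} ≤ p ∧ Fintype.card {i // ![0, s] i ≤ 0} ≤ q

instance (p q : ℕ) : DecidablePred (FlagType.IsAdmissible p q)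
  | .inl s => by unfold FlagType.IsAdmissible; infer_instance
  | .inr s => by unfold FlagType.IsAdmissible; infer_instance

/-- At most three signs are compared with `p` and `q`, so large values need not be distinguished. -/
theorem FlagType.isAdmissible_min_three (p q : ℕ) (t : FlagType) :
    t.IsAdmissible (min p 3) (min q 3) ↔ t.IsAdmissible p q := by
  have h : ∀ {n : ℕ} (_ : n ≤ 3) (P : Fin n → Prop) [DecidablePred P] (k : ℕ),
      Fintype.card {i // P i} ≤ min k 3 ↔ Fintype.card {i // P i} ≤ k := by
    intro n hn P _ k
    have := Fintype.card_subtype_le P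
    rw [Fintype.card_fin] at this
    omega
  cases t <;> simp only [FlagType.IsAdmissible]
  · rw [h le_rfl, h le_rfl]
  · rw [h (by norm_num), h (by norm_num)]

/-- Relative positions are transported by isometries that respect the flags. -/
theorem HasFlagType.map {V' : Type*} [AddCommGroup V'] [Module ℝ V']
    {b' : LinearMap.BilinForm ℝ V'} {D Z : Submodule ℝ V} {D' Z' : Submodule ℝ V'} {t : FlagType}
    (ht : HasFlagType b D Z t) (B : V ≃ₗ[ℝ] V') (h : ∀ x y, b x y = b' (B x) (B y))
    (hD : ∀ x ∈ D, B x ∈ D') (hZ : ∀ y ∈ Z', ∃ x ∈ Z, B x = y) : HasFlagType b' D' Z' t := by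
  have hO : ∀ x ∈ b.orthogonal Z, B x ∈ b'.orthogonal Z' := by
    intro x hx
    rw [LinearMap.BilinForm.mem_orthogonal_iff] at hx ⊢
    intro y hy
    obtain ⟨z, hz, rfl⟩ := hZ y hy
    rw [← h]
    exact hx z hz
  rcases t with s | s
  · obtain ⟨d, hd, v, hv, w, hw, hu⟩ := ht
    refine ⟨B d, hD d hd, B v, hO v hv, B w, hO w hw, ?_⟩
    have e : ![B d, B v, B w] = B ∘ ![d, v, w] := by
      ext i
      fin_cases i <;> rfl
    rw [e]
    exact hu.map B h
  · obtain ⟨d, hd, w, hw, hd', hu⟩ := ht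
    refine ⟨B d, hD d hd, B w, hO w hw, hO d hd', ?_⟩
    have e : ![B d, B w] = B ∘ ![d, w] := by
      ext i
      fin_cases i <;> rfl
    rw [e]
    exact hu.map B h

/-- The sign of a value of a diagonal binary form lies between the signs of its coefficients. -/
theorem SignType.sign_bounds (s t : SignType) {x y : ℝ} (h : x ≠ 0 ∨ y ≠ 0) :
    min s t ≤ SignType.sign (s * (x * x) + t * (y * y)) ∧
      SignType.sign (s * (x * x) + t * (y * y)) ≤ max s t := by
  have hx := mul_self_nonneg x
  have hy := mul_self_nonneg y
  have hxy : 0 < x * x + y * y := by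
    rcases h with h | h
    · have := mul_self_pos.2 h
      positivity
    · have := mul_self_pos.2 h
      positivity
  have top : ∀ a : SignType, a ≤ 1 := by decide
  have bot : ∀ a : SignType, -1 ≤ a := by decide
  have one : ∀ a : SignType, 1 ≤ a ↔ a = 1 := by decide
  have neg : ∀ a : SignType, a ≤ -1 ↔ a = -1 := by decide
  cases s <;> cases t <;>
    simp only [SignType.zero_eq_zero, SignType.neg_eq_neg_one, SignType.pos_eq_one,
      SignType.coe_zero, SignType.coe_one, SignType.coe_neg_one, min_self, max_self,
      min_eq_left (bot _), min_eq_right (bot _), max_eq_left (bot _), max_eq_right (bot _),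
      min_eq_left (top _), min_eq_right (top _), max_eq_left (top _), max_eq_right (top _),
      top, bot, true_and, and_true, one, neg, sign_nonneg_iff, sign_nonpos_iff, sign_eq_one_iff,
      sign_eq_neg_one_iff]
  all_goals first | (constructor <;> linarith) | linarith

section Position

variable [FiniteDimensional ℝ V] {D Z : Submodule ℝ V}

theorem IsScalarProduct.finrank_orthogonal_eq_two (hb : IsScalarProduct p q b)
    (hZ : finrank ℝ Z + 2 = finrank ℝ V) : finrank ℝ (b.orthogonal Z) = 2 := by
  rw [LinearMap.BilinForm.finrank_orthogonal hb.nondegenerate]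
  omega

theorem orthogonal_eq_span_pair (hb : IsScalarProduct p q b) (hZ : finrank ℝ Z + 2 = finrank ℝ V)
    {v w : V} (hv : v ∈ b.orthogonal Z) (hw : w ∈ b.orthogonal Z)
    (h : LinearIndependent ℝ ![v, w]) : Submodule.span ℝ (Set.range ![v, w]) = b.orthogonal Z := by
  refine Submodule.eq_of_le_of_finrank_eq ?_ ?_
  · rw [Submodule.span_le]
    rintro _ ⟨i, rfl⟩
    fin_cases i
    · exact hv
    · exact hw
  · rw [finrank_span_eq_card h, hb.finrank_orthogonal_eq_two hZ, Fintype.card_fin]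

/-- The signs of `b` on a plane with an orthogonal basis `v, w` are those of `v` and `w`. -/
theorem isLeast_isGreatest_sign (hb : IsScalarProduct p q b) (hZ : finrank ℝ Z + 2 = finrank ℝ V)
    {v w : V} {s t : SignType} (hv : v ∈ b.orthogonal Z) (hw : w ∈ b.orthogonal Z)
    (h : IsSignDiagonal b ![s, t] ![v, w]) :
    IsLeast {σ | ∃ x ∈ b.orthogonal Z, x ≠ 0 ∧ SignType.sign (b x x) = σ} (min s t) ∧
    IsGreatest {σ | ∃ x ∈ b.orthogonal Z, x ≠ 0 ∧ SignType.sign (b x x) = σ} (max s t) := by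
  have hs : s ∈ {σ | ∃ x ∈ b.orthogonal Z, x ≠ 0 ∧ SignType.sign (b x x) = σ} := by
    refine ⟨v, hv, h.linearIndependent.ne_zero 0, ?_⟩
    have := h.gram 0 0
    simp only [Matrix.cons_val_zero, if_true] at this
    rw [this, SignType.sign_coe_real]
  have ht : t ∈ {σ | ∃ x ∈ b.orthogonal Z, x ≠ 0 ∧ SignType.sign (b x x) = σ} := by
    refine ⟨w, hw, h.linearIndependent.ne_zero 1, ?_⟩
    have := h.gram 1 1
    simp only [Matrix.cons_val_one, Matrix.cons_val_zero, if_true] at this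
    rw [this, SignType.sign_coe_real]
  have key : ∀ x ∈ b.orthogonal Z, x ≠ 0 →
      min s t ≤ SignType.sign (b x x) ∧ SignType.sign (b x x) ≤ max s t := by
    intro x hx hx0
    rw [← orthogonal_eq_span_pair hb hZ hv hw h.linearIndependent,
      Submodule.mem_span_range_iff_exists_fun] at hx
    obtain ⟨c, rfl⟩ := hx
    rw [h.apply_sum_self, Fin.sum_univ_two]
    refine SignType.sign_bounds s t ?_
    by_contra! hc
    refine hx0 ?_
    simp [hc]
  refine ⟨⟨?_, ?_⟩, ?_, ?_⟩
  · rcases min_choice s t with h | h <;> rw [h] <;> assumption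
  · rintro _ ⟨x, hx, hx0, rfl⟩
    exact (key x hx hx0).1
  · rcases max_choice s t with h | h <;> rw [h] <;> assumption
  · rintro _ ⟨x, hx, hx0, rfl⟩
    exact (key x hx hx0).2

omit [FiniteDimensional ℝ V] in
theorem IsSignDiagonal.tail_pair {s₀ s t : SignType} {d v w : V}
    (h : IsSignDiagonal b ![s₀, s, t] ![d, v, w]) : IsSignDiagonal b ![s, t] ![v, w] := by
  refine ⟨h.linearIndependent.comp Fin.succ (Fin.succ_injective 2), fun i j ↦ ?_⟩
  have := h.gram i.succ j.succ
  simp only [(Fin.succ_injective 2).eq_iff] at this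
  exact this

/-- A vector completing a basis `v, w` of the plane `Zᗮ` to a linearly independent family lies
outside that plane. -/
theorem notMem_orthogonal_of_isSignDiagonal (hb : IsScalarProduct p q b)
    (hZ : finrank ℝ Z + 2 = finrank ℝ V) {s₀ s t : SignType} {d v w : V}
    (hv : v ∈ b.orthogonal Z) (hw : w ∈ b.orthogonal Z)
    (h : IsSignDiagonal b ![s₀, s, t] ![d, v, w]) : d ∉ b.orthogonal Z := by
  rw [← orthogonal_eq_span_pair hb hZ hv hw h.tail_pair.linearIndependent]
  exact (linearIndependent_finCons.1 h.linearIndependent).2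

omit [FiniteDimensional ℝ V] in
theorem exists_smul_eq_of_mem_line (hD : finrank ℝ D = 1) {d d' : V} (hd : d ∈ D) (hd' : d' ∈ D)
    (h0 : d ≠ 0) : ∃ c : ℝ, c • d = d' := by
  obtain ⟨c, hc⟩ := (finrank_eq_one_iff_of_nonzero' (⟨d, hd⟩ : D) (by simpa using h0)).1 hD ⟨d', hd'⟩
  exact ⟨c, congrArg Subtype.val hc⟩

/-- The relative position is unique. -/
theorem HasFlagType.unique (hb : IsScalarProduct p q b) (hD : finrank ℝ D = 1)
    (hZ : finrank ℝ Z + 2 = finrank ℝ V) {t t' : FlagType} (h : HasFlagType b D Z t)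
    (h' : HasFlagType b D Z t') (ha : t.IsAdmissible p q) (ha' : t'.IsAdmissible p q) : t = t' := by
  -- `D ⊂ Zᗮ` can be decided on any nonzero vector of `D`
  have hmem : ∀ {d d' : V}, d ∈ D → d' ∈ D → d ≠ 0 → d ∈ b.orthogonal Z → d' ∈ b.orthogonal Z := by
    intro d d' hd hd' h0 h
    obtain ⟨c, rfl⟩ := exists_smul_eq_of_mem_line hD hd hd' h0
    exact Submodule.smul_mem _ c h
  rcases t with ⟨s₀, s₁, s₂⟩ | s <;> rcases t' with ⟨s₀', s₁', s₂'⟩ | s'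
  · obtain ⟨d, hd, v, hv, w, hw, hu⟩ := h
    obtain ⟨d', hd', v', hv', w', hw', hu'⟩ := h'
    obtain ⟨h1, h2⟩ := isLeast_isGreatest_sign hb hZ hv hw hu.tail_pair
    obtain ⟨h1', h2'⟩ := isLeast_isGreatest_sign hb hZ hv' hw' hu'.tail_pair
    have e1 := h1.unique h1'
    have e2 := h2.unique h2'
    rw [min_eq_left ha.1, min_eq_left ha'.1] at e1
    rw [max_eq_right ha.1, max_eq_right ha'.1] at e2
    have g : b d d = s₀ := by simpa using hu.gram 0 0
    have g' : b d' d' = s₀' := by simpa using hu'.gram 0 0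
    have d0 : d' ≠ 0 := hu'.linearIndependent.ne_zero 0
    obtain ⟨c, rfl⟩ := exists_smul_eq_of_mem_line hD hd hd' (hu.linearIndependent.ne_zero 0)
    have hc : c ≠ 0 := by
      rintro rfl
      exact d0 (zero_smul ℝ d)
    have e0 : s₀ = s₀' := by
      rw [← SignType.sign_coe_real s₀, ← SignType.sign_coe_real s₀', ← g, ← g']
      simp only [map_smul, LinearMap.smul_apply, smul_eq_mul]
      rw [← mul_assoc, sign_mul, sign_pos (mul_self_pos.2 hc), one_mul]
    subst e0
    simp only at e1 e2
    rw [e1, e2]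
  · obtain ⟨d, hd, v, hv, w, hw, hu⟩ := h
    obtain ⟨d', hd', w', hw', hdw', hu'⟩ := h'
    exact absurd (hmem hd' hd (hu'.linearIndependent.ne_zero 0) hdw')
      (notMem_orthogonal_of_isSignDiagonal hb hZ hv hw hu)
  · obtain ⟨d, hd, w, hw, hdw, hu⟩ := h
    obtain ⟨d', hd', v', hv', w', hw', hu'⟩ := h'
    exact absurd (hmem hd hd' (hu.linearIndependent.ne_zero 0) hdw)
      (notMem_orthogonal_of_isSignDiagonal hb hZ hv' hw' hu')
  · obtain ⟨d, hd, w, hw, hdw, hu⟩ := h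
    obtain ⟨d', hd', w', hw', hdw', hu'⟩ := h'
    obtain ⟨h1, h2⟩ := isLeast_isGreatest_sign hb hZ hdw hw hu
    obtain ⟨h1', h2'⟩ := isLeast_isGreatest_sign hb hZ hdw' hw' hu'
    have := (by decide : ∀ s s' : SignType, min 0 s = min 0 s' → max 0 s = max 0 s' → s = s')
    rw [this s s' (h1.unique h1') (h2.unique h2')]

/-- Scalar products in the same relative position to a flag are related by a linear automorphism
preserving the flag. -/
theorem exists_flag_isometry (hb : IsScalarProduct p q b) (hb' : IsScalarProduct p q b')
    (hD : finrank ℝ D = 1) (hZ : finrank ℝ Z + 2 = finrank ℝ V) {t : FlagType}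
    (h : HasFlagType b D Z t) (h' : HasFlagType b' D Z t) :
    ∃ B : V ≃ₗ[ℝ] V, (∀ x ∈ D, B x ∈ D) ∧ (∀ x ∈ Z, B x ∈ Z) ∧ ∀ x y, b x y = b' (B x) (B y) := by
  obtain ⟨d, d', v, v', w, w', hd, hd', hv, hv', hw, hw', hd0, hl, hl', B, h1, h2, h3, h4⟩ :
      ∃ d d' v v' w w', d ∈ D ∧ d' ∈ D ∧ v ∈ b.orthogonal Z ∧ v' ∈ b'.orthogonal Z ∧
        w ∈ b.orthogonal Z ∧ w' ∈ b'.orthogonal Z ∧ d ≠ 0 ∧ LinearIndependent ℝ ![v, w] ∧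
        LinearIndependent ℝ ![v', w'] ∧ ∃ B : V ≃ₗ[ℝ] V,
          B d = d' ∧ B v = v' ∧ B w = w' ∧ ∀ x y, b x y = b' (B x) (B y) := by
    rcases t with s | s
    · obtain ⟨d, hd, v, hv, w, hw, hu⟩ := h
      obtain ⟨d', hd', v', hv', w', hw', hu'⟩ := h'
      obtain ⟨B, hB, hB'⟩ := exists_isometry_of_gram_eq hb hb' hu.linearIndependent
        hu'.linearIndependent fun i j ↦ by rw [hu.gram, hu'.gram]
      exact ⟨d, d', v, v', w, w', hd, hd', hv, hv', hw, hw', hu.linearIndependent.ne_zero 0,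
        hu.tail_pair.linearIndependent, hu'.tail_pair.linearIndependent, B, hB 0, hB 1, hB 2, hB'⟩
    · obtain ⟨d, hd, w, hw, hdw, hu⟩ := h
      obtain ⟨d', hd', w', hw', hdw', hu'⟩ := h'
      obtain ⟨B, hB, hB'⟩ := exists_isometry_of_gram_eq hb hb' hu.linearIndependent
        hu'.linearIndependent fun i j ↦ by rw [hu.gram, hu'.gram]
      exact ⟨d, d', d, d', w, w', hd, hd', hdw, hdw', hw, hw', hu.linearIndependent.ne_zero 0,
        hu.linearIndependent, hu'.linearIndependent, B, hB 0, hB 0, hB 1, hB'⟩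
  refine ⟨B, fun x hx ↦ ?_, fun x hx ↦ ?_, h4⟩
  · obtain ⟨c, rfl⟩ := exists_smul_eq_of_mem_line hD hd hx hd0
    rw [map_smul, h1]
    exact D.smul_mem c hd'
  · rw [← LinearMap.BilinForm.orthogonal_orthogonal hb'.nondegenerate hb'.isRefl Z,
      LinearMap.BilinForm.mem_orthogonal_iff]
    intro y hy
    rw [← orthogonal_eq_span_pair hb' hZ hv' hw' hl', Submodule.mem_span_range_iff_exists_fun] at hy
    obtain ⟨c, rfl⟩ := hy
    have e1 : b v x = 0 := (hb.symm v x).trans (hv x hx)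
    have e2 : b w x = 0 := (hb.symm w x).trans (hw x hx)
    rw [h4, h2] at e1
    rw [h4, h3] at e2
    simp [Fin.sum_univ_two, e1, e2]

end Position

end Flags

/-! ### The relative positions that occur -/

section Flags

open Module

variable {V : Type*} [AddCommGroup V] [Module ℝ V] {p q : ℕ} {b : LinearMap.BilinForm ℝ V}

theorem exists_smul_apply_self_eq_sign (b : LinearMap.BilinForm ℝ V) (v : V) :
    ∃ r : ℝ, r ≠ 0 ∧ b (r • v) (r • v) = SignType.sign (b v v) := by
  by_cases h : b v v = 0
  · exact ⟨1, one_ne_zero, by simp [h]⟩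
  · have h' := abs_pos.2 h
    refine ⟨(√|b v v|)⁻¹, by positivity, ?_⟩
    simp only [map_smul, LinearMap.smul_apply, smul_eq_mul]
    rw [← mul_assoc, ← mul_inv, Real.mul_self_sqrt h'.le, inv_mul_eq_iff_eq_mul₀ h'.ne',
      mul_comm, sign_mul_abs]

section Existence

variable [FiniteDimensional ℝ V] {D Z : Submodule ℝ V}

/-- Every scalar product has an admissible relative position to the flag `D ⊂ Z`. -/
theorem exists_hasFlagType (hb : IsScalarProduct p q b) (hD : finrank ℝ D = 1)
    (hZ : finrank ℝ Z + 2 = finrank ℝ V) (hDZ : D ≤ Z) :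
    ∃ t : FlagType, t.IsAdmissible p q ∧ HasFlagType b D Z t := by
  have hW := hb.finrank_orthogonal_eq_two hZ
  obtain ⟨⟨d, hd⟩, hd0, -⟩ := finrank_eq_one_iff'.1 hD
  replace hd0 : d ≠ 0 := fun h ↦ hd0 (Subtype.ext h)
  have hdW : ∀ v ∈ b.orthogonal Z, b d v = 0 := fun v hv ↦ hv d (hDZ hd)
  by_cases hdo : d ∈ b.orthogonal Z
  · obtain ⟨w, hw, hwd⟩ : ∃ w ∈ b.orthogonal Z, w ∉ Submodule.span ℝ {d} := by
      by_contra! h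
      have h1 := Submodule.finrank_mono (show b.orthogonal Z ≤ Submodule.span ℝ {d} from h)
      rw [hW, finrank_span_singleton hd0] at h1
      omega
    obtain ⟨r, hr, hrw⟩ := exists_smul_apply_self_eq_sign b w
    have hu : IsSignDiagonal b ![0, SignType.sign (b w w)] ![d, r • w] := by
      refine ⟨?_, ?_⟩
      · rw [LinearIndependent.pair_iff' hd0]
        intro a ha
        refine hwd (Submodule.mem_span_singleton.2 ⟨r⁻¹ * a, ?_⟩)
        rw [mul_smul, ha, smul_smul, inv_mul_cancel₀ hr, one_smul]
      · have h1 : b d d = 0 := hdW d hdo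
        have h2 : b d w = 0 := hdW w hw
        have h3 : b w d = 0 := (hb.symm w d).trans h2
        intro i j
        fin_cases i <;> fin_cases j
        · simp [h1]
        · simp [h2]
        · simp [h3]
        · simpa using hrw
    exact ⟨.inr (SignType.sign (b w w)), ⟨hu.card_nonneg_le hb, hu.card_nonpos_le hb⟩,
      d, hd, r • w, Submodule.smul_mem _ r hw, hdo, hu⟩
  · -- an orthogonal basis of `Zᗮ`, with increasing signs
    obtain ⟨v, hv, w, hw, hvw, hli, hs⟩ : ∃ v ∈ b.orthogonal Z, ∃ w ∈ b.orthogonal Z, b v w = 0 ∧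
        LinearIndependent ℝ ![v, w] ∧ SignType.sign (b v v) ≤ SignType.sign (b w w) := by
      obtain ⟨β, hβ⟩ : ∃ β : Basis (Fin 2) ℝ (b.orthogonal Z), b (β 0) (β 1) = 0 := by
        obtain ⟨β, hβ⟩ := LinearMap.BilinForm.exists_orthogonal_basis (K := ℝ)
          (B := b.restrict (b.orthogonal Z)) ⟨fun x y ↦ hb.symm x y⟩
        refine ⟨β.reindex (finCongr hW), ?_⟩
        rw [Basis.reindex_apply, Basis.reindex_apply]
        exact hβ ((finCongr hW).symm.injective.ne zero_ne_one)
      have hβ' : LinearIndependent ℝ ![(β 0 : V), β 1] := by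
        have := β.linearIndependent.map' _ (Submodule.ker_subtype _)
        convert! this using 1
        ext i : 1
        fin_cases i <;> rfl
      rcases le_total (SignType.sign (b (β 0) (β 0))) (SignType.sign (b (β 1) (β 1))) with h | h
      · exact ⟨β 0, (β 0).2, β 1, (β 1).2, hβ, hβ', h⟩
      · exact ⟨β 1, (β 1).2, β 0, (β 0).2, (hb.symm _ _).trans hβ,
          LinearIndependent.pair_symm_iff.1 hβ', h⟩
    obtain ⟨l, hl, hld⟩ := exists_smul_apply_self_eq_sign b d
    obtain ⟨r, hr, hrv⟩ := exists_smul_apply_self_eq_sign b v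
    obtain ⟨r', hr', hrw⟩ := exists_smul_apply_self_eq_sign b w
    have hli' : LinearIndependent ℝ ![r • v, r' • w] := by
      rw [LinearIndependent.pair_iff] at hli ⊢
      intro x y hxy
      rw [smul_smul, smul_smul] at hxy
      obtain ⟨h1, h2⟩ := hli _ _ hxy
      exact ⟨(mul_eq_zero.1 h1).resolve_right hr, (mul_eq_zero.1 h2).resolve_right hr'⟩
    have hrv' := Submodule.smul_mem _ r hv
    have hrw' := Submodule.smul_mem _ r' hw
    have hu : IsSignDiagonal b
        ![SignType.sign (b d d), SignType.sign (b v v), SignType.sign (b w w)]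
        ![l • d, r • v, r' • w] := by
      refine ⟨linearIndependent_finCons.2 ⟨hli', ?_⟩, ?_⟩
      · rw [orthogonal_eq_span_pair hb hZ hrv' hrw' hli', Submodule.smul_mem_iff _ hl]
        exact hdo
      · have h1 := hdW v hv
        have h2 := hdW w hw
        have h3 := (hb.symm v d).trans h1
        have h4 := (hb.symm w d).trans h2
        have h5 := (hb.symm w v).trans hvw
        intro i j
        fin_cases i <;> fin_cases j
        · simpa using hld
        · simp [h1]
        · simp [h2]
        · simp [h3]
        · simpa using hrv
        · simp [hvw]
        · simp [h4]
        · simp [h5]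
        · simpa using hrw
    exact ⟨.inl (SignType.sign (b d d), SignType.sign (b v v), SignType.sign (b w w)),
      ⟨hs, hu.card_nonneg_le hb, hu.card_nonpos_le hb⟩, l • d, D.smul_mem l hd, r • v, hrv',
      r' • w, hrw', hu⟩

end Existence

section Transitivity

variable {V' : Type*} [AddCommGroup V'] [Module ℝ V']

theorem exists_linearEquiv_extending [FiniteDimensional ℝ V] [FiniteDimensional ℝ V']
    (h : finrank ℝ V = finrank ℝ V') {Z : Submodule ℝ V} {Z' : Submodule ℝ V'}
    (f : Z ≃ₗ[ℝ] Z') : ∃ e : V ≃ₗ[ℝ] V', ∀ x : Z, e x = f x := by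
  obtain ⟨Q, hQ⟩ := Submodule.exists_isCompl Z
  obtain ⟨Q', hQ'⟩ := Submodule.exists_isCompl Z'
  have h1 := Submodule.finrank_add_eq_of_isCompl hQ
  have h2 := Submodule.finrank_add_eq_of_isCompl hQ'
  have h3 := f.finrank_eq
  refine ⟨(Submodule.prodEquivOfIsCompl Z Q hQ).symm ≪≫ₗ LinearEquiv.prodCongr f
    (LinearEquiv.ofFinrankEq Q Q' (by omega)) ≪≫ₗ Submodule.prodEquivOfIsCompl Z' Q' hQ',
    fun x ↦ ?_⟩
  simp

/-- Flags of the same dimensions correspond under a linear equivalence. -/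
theorem exists_linearEquiv_flag [FiniteDimensional ℝ V] [FiniteDimensional ℝ V']
    (h : finrank ℝ V = finrank ℝ V') {D Z : Submodule ℝ V} {D' Z' : Submodule ℝ V'}
    (hDZ : D ≤ Z) (hDZ' : D' ≤ Z') (hD : finrank ℝ D = finrank ℝ D')
    (hZ : finrank ℝ Z = finrank ℝ Z') :
    ∃ e : V ≃ₗ[ℝ] V', (∀ x ∈ D, e x ∈ D') ∧ ∀ x ∈ Z, e x ∈ Z' := by
  obtain ⟨f, hf⟩ := exists_linearEquiv_extending hZ (Submodule.submoduleOfEquivOfLe hDZ ≪≫ₗ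
    LinearEquiv.ofFinrankEq D D' hD ≪≫ₗ (Submodule.submoduleOfEquivOfLe hDZ').symm)
  obtain ⟨e, he⟩ := exists_linearEquiv_extending h f
  refine ⟨e, fun x hx ↦ ?_, fun x hx ↦ ?_⟩
  · have key : ∀ y : D'.submoduleOf Z', ((y : Z') : V') ∈ D' := fun y ↦ y.2
    rw [he ⟨x, hDZ hx⟩, hf ⟨⟨x, hDZ hx⟩, hx⟩]
    exact key _
  · rw [he ⟨x, hx⟩]
    exact Subtype.prop _

theorem exists_mem_apply_eq_of_finrank_eq [FiniteDimensional ℝ V'] {U : Submodule ℝ V}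
    {U' : Submodule ℝ V'} (e : V ≃ₗ[ℝ] V') (h : ∀ x ∈ U, e x ∈ U')
    (hU : finrank ℝ U = finrank ℝ U') {y : V'} (hy : y ∈ U') : ∃ x ∈ U, e x = y := by
  have : U.map e.toLinearMap = U' := by
    refine Submodule.eq_of_le_of_finrank_eq ?_ ?_
    · rintro _ ⟨x, hx, rfl⟩
      exact h x hx
    · rw [← hU]
      exact e.finrank_map_eq U
  rw [← this] at hy
  obtain ⟨x, hx, rfl⟩ := hy
  exact ⟨x, hx, rfl⟩

end Transitivity

/-- Every admissible relative position occurs. -/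
theorem exists_isScalarProduct_hasFlagType [FiniteDimensional ℝ V] {D Z : Submodule ℝ V}
    (hV : finrank ℝ V = p + q) (hD : finrank ℝ D = 1) (hZ : finrank ℝ Z + 2 = finrank ℝ V)
    (hDZ : D ≤ Z) {t : FlagType} (ht : t.IsAdmissible p q) :
    ∃ b : LinearMap.BilinForm ℝ V, IsScalarProduct p q b ∧ HasFlagType b D Z t := by
  have hs := isScalarProduct_standardForm p q
  -- it suffices to find a flag in the standard space in this position
  suffices h : ∃ D' Z' : Submodule ℝ (Fin p ⊕ Fin q → ℝ), D' ≤ Z' ∧ finrank ℝ D' = 1 ∧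
      finrank ℝ Z' + 2 = p + q ∧ HasFlagType (standardForm p q) D' Z' t by
    obtain ⟨D', Z', h1, h2, h3, h4⟩ := h
    obtain ⟨e, he, he'⟩ := exists_linearEquiv_flag (hV.trans hs.finrank_eq.symm) hDZ h1
      (hD.trans h2.symm) (by omega)
    refine ⟨(standardForm p q).compl₁₂ e.toLinearMap e.toLinearMap,
      hs.comp e fun x y ↦ rfl, h4.map e.symm (fun x y ↦ ?_) (fun x hx ↦ ?_) fun x hx ↦ ?_⟩
    · simp
    · obtain ⟨y, hy, rfl⟩ := exists_mem_apply_eq_of_finrank_eq e he (hD.trans h2.symm) hx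
      rwa [e.symm_apply_apply]
    · exact ⟨e x, he' x hx, e.symm_apply_apply x⟩
  have key : ∀ {d v w : Fin p ⊕ Fin q → ℝ}, d ≠ 0 → LinearIndependent ℝ ![v, w] →
      standardForm p q v d = 0 → standardForm p q w d = 0 →
      ∃ D' Z' : Submodule ℝ (Fin p ⊕ Fin q → ℝ), D' ≤ Z' ∧ finrank ℝ D' = 1 ∧
        finrank ℝ Z' + 2 = p + q ∧ d ∈ D' ∧ v ∈ (standardForm p q).orthogonal Z' ∧
        w ∈ (standardForm p q).orthogonal Z' := by
    intro d v w hd hvw h1 h2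
    refine ⟨Submodule.span ℝ {d}, (standardForm p q).orthogonal
      (Submodule.span ℝ (Set.range ![v, w])), ?_, finrank_span_singleton hd, ?_,
      Submodule.mem_span_singleton_self d, ?_, ?_⟩
    · rw [Submodule.span_singleton_le_iff_mem, LinearMap.BilinForm.mem_orthogonal_iff]
      intro y hy
      obtain ⟨c, rfl⟩ := (Submodule.mem_span_range_iff_exists_fun ℝ).1 hy
      simp [Fin.sum_univ_two, h1, h2]
    · have h3 := hvw.fintype_card_le_finrank
      rw [LinearMap.BilinForm.finrank_orthogonal hs.nondegenerate, finrank_span_eq_card hvw]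
      rw [hs.finrank_eq, Fintype.card_fin] at *
      omega
    · exact LinearMap.BilinForm.le_orthogonal_orthogonal hs.isRefl
        (Submodule.subset_span ⟨0, rfl⟩)
    · exact LinearMap.BilinForm.le_orthogonal_orthogonal hs.isRefl
        (Submodule.subset_span ⟨1, rfl⟩)
  rcases t with ⟨s₀, s₁, s₂⟩ | s
  · obtain ⟨u, hu⟩ := exists_isSignDiagonal ht.2.1 ht.2.2
    have e : u = ![u 0, u 1, u 2] := by
      ext i : 1
      fin_cases i <;> rfl
    have hu' := e ▸ hu
    obtain ⟨D', Z', h1, h2, h3, h4, h5, h6⟩ := key (hu.linearIndependent.ne_zero 0)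
      hu'.tail_pair.linearIndependent (hu.gram 1 0) (hu.gram 2 0)
    exact ⟨D', Z', h1, h2, h3, u 0, h4, u 1, h5, u 2, h6, hu'⟩
  · obtain ⟨u, hu⟩ := exists_isSignDiagonal ht.1 ht.2
    have e : u = ![u 0, u 1] := by
      ext i : 1
      fin_cases i <;> rfl
    have hu' := e ▸ hu
    obtain ⟨D', Z', h1, h2, h3, h4, h5, h6⟩ := key (hu.linearIndependent.ne_zero 0)
      hu'.linearIndependent (by simpa using hu.gram 0 0) (hu.gram 1 0)
    exact ⟨D', Z', h1, h2, h3, u 0, h4, u 1, h6, h5, hu'⟩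

end Flags

/-! ### Calculus on a vector space with the standard manifold structure -/

section VectorSpace

variable {E : Type*} [NormedAddCommGroup E] [NormedSpace ℝ E]

/-- A smooth family of bilinear forms on `E` is a smooth section of the bundle of bilinear forms
on the tangent spaces of `E`. -/
theorem contMDiff_bilin_section_self {f : E → E →L[ℝ] E →L[ℝ] ℝ} (hf : ContDiff ℝ ∞ f) :
    ContMDiff 𝓘(ℝ, E) (𝓘(ℝ, E).prod 𝓘(ℝ, E →L[ℝ] E →L[ℝ] ℝ)) ∞
      (fun a ↦ TotalSpace.mk' (E →L[ℝ] E →L[ℝ] ℝ) (E := fun a : E ↦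
        TangentSpace 𝓘(ℝ, E) a →L[ℝ] TangentSpace 𝓘(ℝ, E) a →L[ℝ] ℝ) a (f a)) := by
  intro x
  rw [contMDiffAt_hom_bundle]
  refine ⟨contMDiff_id x, ?_⟩
  refine (hf.contMDiff x).congr_of_eventuallyEq (Filter.Eventually.of_forall fun y ↦ ?_)
  ext u v
  have hy : y ∈ (trivializationAt E (TangentSpace 𝓘(ℝ, E)) x).baseSet := by
    rw [TangentBundle.trivializationAt_baseSet]
    exact Set.mem_univ y
  refine (inCoordinates_apply_eq₂ (𝕜 := ℝ) (F₁ := E) (F₂ := E) (F₃ := ℝ)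
    (E₁ := TangentSpace 𝓘(ℝ, E)) (E₂ := TangentSpace 𝓘(ℝ, E)) (E₃ := fun _ ↦ ℝ)
    (x₀ := x) (x := y) (ϕ := f y) (v := u) (w := v) hy hy (by simp)).trans ?_
  have h1 : ∀ w : E, (trivializationAt E (TangentSpace 𝓘(ℝ, E)) x).symm y w = w := fun w ↦
    (Trivialization.symmL_apply (R := ℝ) _ hy w).symm.trans
      (congrArg (fun L : E →L[ℝ] E ↦ L w) (TangentBundle.symmL_model_space (𝕜 := ℝ) x y))
  simp only [h1]
  simp
  rfl

/- The model with corners and the atlas of the product manifold `H₃ × ℝ^m` are only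
propositionally equal to the standard ones, so they are carried along as variables. -/
variable (I : ModelWithCorners ℝ E E) (c : ChartedSpace E E)

theorem contMDiff_bilin_section_of_eq (hI : I = 𝓘(ℝ, E)) (hc : c = chartedSpaceSelf E)
    [IsManifold I 1 E] {f : E → E →L[ℝ] E →L[ℝ] ℝ} (hf : ContDiff ℝ ∞ f) :
    ContMDiff I (I.prod 𝓘(ℝ, E →L[ℝ] E →L[ℝ] ℝ)) ∞
      (fun a ↦ TotalSpace.mk' (E →L[ℝ] E →L[ℝ] ℝ) (E := fun a : E ↦
        TangentSpace I a →L[ℝ] TangentSpace I a →L[ℝ] ℝ) a (f a)) := by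
  subst hI hc
  exact contMDiff_bilin_section_self hf

theorem contMDiff_iff_contDiff_of_eq (hI : I = 𝓘(ℝ, E)) (hc : c = chartedSpaceSelf E)
    (f : E → E) : ContMDiff I I ∞ f ↔ ContDiff ℝ ∞ f := by
  subst hI hc
  exact contMDiff_iff_contDiff

theorem mfderiv_eq_fderiv_of_eq (hI : I = 𝓘(ℝ, E)) (hc : c = chartedSpaceSelf E)
    (f : E → E) (a : E) : mfderiv I I f a = fderiv ℝ f a := by
  subst hI hc
  exact mfderiv_eq_fderiv

end VectorSpace

/-! ### The group `H₃ × ℝ^m` in exponential coordinates -/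

/-- The Lie group `H₃ × ℝ^m`. -/
abbrev HeisenbergProd (m : ℕ) : Type := Heisenberg × VectorGroup m

/-- The vector space underlying `H₃ × ℝ^m`, which is also its Lie algebra. -/
abbrev HeisenbergAlg (m : ℕ) : Type := (ℝ × ℝ × ℝ) × (Fin m → ℝ)

namespace HeisenbergAlg

variable {m : ℕ}

theorem contMDiff_bilin_section
    {f : HeisenbergAlg m → HeisenbergAlg m →L[ℝ] HeisenbergAlg m →L[ℝ] ℝ}
    (hf : ContDiff ℝ ∞ f) :
    ContMDiff (heisenbergModel m)
      ((heisenbergModel m).prod 𝓘(ℝ, HeisenbergAlg m →L[ℝ] HeisenbergAlg m →L[ℝ] ℝ)) ∞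
      (fun a ↦ TotalSpace.mk' (HeisenbergAlg m →L[ℝ] HeisenbergAlg m →L[ℝ] ℝ)
        (E := fun a : HeisenbergProd m ↦ TangentSpace (heisenbergModel m) a →L[ℝ]
          TangentSpace (heisenbergModel m) a →L[ℝ] ℝ) a (f a)) := by
  have : IsManifold (heisenbergModel m) 1 (HeisenbergProd m) := inferInstance
  exact @contMDiff_bilin_section_of_eq (HeisenbergAlg m) _ _ (heisenbergModel m)
    (prodChartedSpace _ Heisenberg _ (VectorGroup m)) modelWithCornersSelf_prod.symm
    chartedSpaceSelf_prod this f hf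

/-- The exponential coordinates of an element of `H₃ × ℝ^m`. -/
def coords (a : HeisenbergProd m) : HeisenbergAlg m := a

/-- The exponential map of `H₃ × ℝ^m`, the inverse of `coords`. -/
def exp (a : HeisenbergAlg m) : HeisenbergProd m := a

@[simp] theorem coords_exp (a : HeisenbergAlg m) : coords (exp a) = a := rfl

@[simp] theorem exp_coords (a : HeisenbergProd m) : exp (coords a) = a := rfl

@[simp] theorem coords_inv (a : HeisenbergProd m) : coords a⁻¹ = -coords a := rfl

theorem contMDiff_iff (f : HeisenbergProd m → HeisenbergProd m) :
    ContMDiff (heisenbergModel m) (heisenbergModel m) ∞ f ↔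
      ContDiff ℝ ∞ fun v ↦ coords (f (exp v)) :=
  @contMDiff_iff_contDiff_of_eq (HeisenbergAlg m) _ _ (heisenbergModel m)
    (prodChartedSpace _ Heisenberg _ (VectorGroup m)) modelWithCornersSelf_prod.symm
    chartedSpaceSelf_prod f

theorem mfderiv_eq (f : HeisenbergProd m → HeisenbergProd m) (a : HeisenbergProd m) :
    mfderiv (heisenbergModel m) (heisenbergModel m) f a =
      fderiv ℝ (fun v ↦ coords (f (exp v))) (coords a) :=
  @mfderiv_eq_fderiv_of_eq (HeisenbergAlg m) _ _ (heisenbergModel m)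
    (prodChartedSpace _ Heisenberg _ (VectorGroup m)) modelWithCornersSelf_prod.symm
    chartedSpaceSelf_prod f a

/-- The first coordinate of the `H₃` factor. -/
noncomputable def X (m : ℕ) : HeisenbergAlg m →L[ℝ] ℝ :=
  (ContinuousLinearMap.fst ℝ ℝ (ℝ × ℝ)).comp (ContinuousLinearMap.fst ℝ (ℝ × ℝ × ℝ) (Fin m → ℝ))

/-- The second coordinate of the `H₃` factor. -/
noncomputable def Y (m : ℕ) : HeisenbergAlg m →L[ℝ] ℝ :=
  ((ContinuousLinearMap.fst ℝ ℝ ℝ).comp (ContinuousLinearMap.snd ℝ ℝ (ℝ × ℝ))).comp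
    (ContinuousLinearMap.fst ℝ (ℝ × ℝ × ℝ) (Fin m → ℝ))

/-- The generator of the derived algebra. -/
def ez (m : ℕ) : HeisenbergAlg m := ((0, 0, 1), 0)

@[simp] theorem X_ez : X m (ez m) = 0 := rfl

@[simp] theorem Y_ez : Y m (ez m) = 0 := rfl

theorem ez_ne_zero : ez m ≠ 0 := fun h ↦
  one_ne_zero (congrArg (fun v : HeisenbergAlg m ↦ v.1.2.2) h)

/-- The alternating form that gives the Lie bracket, `[a, b] = symp a b • ez`. -/
noncomputable def symp (a b : HeisenbergAlg m) : ℝ := X m a * Y m b - Y m a * X m b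

/-- The group law in exponential coordinates, an instance of the Baker–Campbell–Hausdorff
formula. -/
theorem coords_mul (a b : HeisenbergProd m) :
    coords (a * b) = coords a + coords b + (symp (coords a) (coords b) / 2) • ez m := by
  refine Prod.ext (Prod.ext ?_ (Prod.ext ?_ ?_)) ?_
  · show a.1.1 + b.1.1 = a.1.1 + b.1.1 + (symp (coords a) (coords b) / 2) * 0
    ring
  · show a.1.2.1 + b.1.2.1 = a.1.2.1 + b.1.2.1 + (symp (coords a) (coords b) / 2) * 0
    ring
  · show a.1.2.2 + b.1.2.2 + (a.1.1 * b.1.2.1 - a.1.2.1 * b.1.1) / 2 =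
      a.1.2.2 + b.1.2.2 + (symp (coords a) (coords b) / 2) * 1
    rw [mul_one]
    rfl
  · show (coords a).2 + (coords b).2 =
      (coords a).2 + (coords b).2 + (symp (coords a) (coords b) / 2) • (0 : Fin m → ℝ)
    simp

/-- The differential of the left translation by `a`. In exponential coordinates it does not depend
on the base point. -/
noncomputable def dL (a : HeisenbergAlg m) : HeisenbergAlg m →L[ℝ] HeisenbergAlg m :=
  .id ℝ _ + ((1 / 2 : ℝ) • (X m a • Y m - Y m a • X m)).smulRight (ez m)

theorem dL_apply (a v : HeisenbergAlg m) : dL a v = v + (symp a v / 2) • ez m := by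
  simp [dL, symp]
  ring_nf

theorem mfderiv_mul_left (b a : HeisenbergProd m) :
    mfderiv (heisenbergModel m) (heisenbergModel m) (fun c : HeisenbergProd m ↦ b * c) a =
      dL (coords b) := by
  refine (mfderiv_eq _ a).trans ?_
  have : (fun c ↦ coords (b * exp c)) = fun c ↦ coords b + dL (coords b) c := by
    funext c
    rw [coords_mul, dL_apply, coords_exp, ← add_assoc]
  rw [this, fderiv_const_add]
  exact (dL (coords b)).fderiv

theorem dL_zero (v : HeisenbergAlg m) : dL 0 v = v := by
  simp [dL_apply, symp]

theorem dL_neg_dL (a v : HeisenbergAlg m) : dL (-a) (dL a v) = v := by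
  simp only [dL_apply, symp, map_neg, map_add, map_smul, X_ez, Y_ez]
  module

theorem dL_neg_mul_dL (b a : HeisenbergProd m) (v : HeisenbergAlg m) :
    dL (-coords (b * a)) (dL (coords b) v) = dL (-coords a) v := by
  rw [coords_mul]
  simp only [dL_apply, symp, map_neg, map_add, map_smul, X_ez, Y_ez, smul_eq_mul]
  module

end HeisenbergAlg

/-! ### Left-invariant metrics as scalar products on the Lie algebra -/

namespace HeisenbergAlg

open Module

variable {m p q : ℕ}

/-- The derived algebra of `𝔥₃ × ℝ^m`. -/
def derived (m : ℕ) : Submodule ℝ (HeisenbergAlg m) := Submodule.span ℝ {ez m}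

/-- The center of `𝔥₃ × ℝ^m`. -/
noncomputable def center (m : ℕ) : Submodule ℝ (HeisenbergAlg m) :=
  LinearMap.ker ((X m).prod (Y m)).toLinearMap

theorem mem_center {v : HeisenbergAlg m} : v ∈ center m ↔ X m v = 0 ∧ Y m v = 0 := by
  simp [center]

theorem derived_le_center : derived m ≤ center m := by
  rw [derived, Submodule.span_singleton_le_iff_mem, mem_center]
  exact ⟨rfl, rfl⟩

theorem finrank_derived : finrank ℝ (derived m) = 1 := finrank_span_singleton ez_ne_zero

theorem finrank_eq : finrank ℝ (HeisenbergAlg m) = m + 3 := by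
  simp [HeisenbergAlg, add_comm]

theorem finrank_center : finrank ℝ (center m) + 2 = finrank ℝ (HeisenbergAlg m) := by
  have h := LinearMap.finrank_range_add_finrank_ker ((X m).prod (Y m)).toLinearMap
  have h' : LinearMap.range ((X m).prod (Y m)).toLinearMap = ⊤ :=
    LinearMap.range_eq_top.2 fun v ↦ ⟨((v.1, v.2, 0), 0), rfl⟩
  rw [h', finrank_top, finrank_prod, finrank_self] at h
  rw [← h, center]
  omega

/-- The value at the identity of a left-invariant metric. -/
noncomputable def form (g : LeftInvariantMetric (heisenbergModel m) (HeisenbergProd m) p q) :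
    HeisenbergAlg m →L[ℝ] HeisenbergAlg m →L[ℝ] ℝ := g.inner 1

/-- A left-invariant metric is determined by its value at the identity. -/
theorem inner_eq (g : LeftInvariantMetric (heisenbergModel m) (HeisenbergProd m) p q)
    (a : HeisenbergProd m) (x y : HeisenbergAlg m) :
    g.inner a x y = form g (dL (-coords a) x) (dL (-coords a) y) := by
  have h := g.left_invariant a⁻¹ a x y
  have aux : ∀ (b : HeisenbergProd m), b = 1 → ∀ u v : HeisenbergAlg m,
      g.inner b u v = form g u v := by
    rintro b rfl u v
    rfl
  rw [mfderiv_mul_left, coords_inv] at h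
  exact h.symm.trans (aux _ (inv_mul_cancel a) _ _)

theorem isScalarProduct_form (hm : m + 3 = p + q)
    (g : LeftInvariantMetric (heisenbergModel m) (HeisenbergProd m) p q) :
    IsScalarProduct p q (form g).toLinearMap₁₂ :=
  ⟨g.symm 1, g.nondegenerate 1, g.sigPos_eq 1, g.sigNeg_eq 1, finrank_eq.trans hm⟩

/-- The differential of a left translation, as a linear automorphism. -/
noncomputable def dLEquiv (a : HeisenbergAlg m) : HeisenbergAlg m ≃ₗ[ℝ] HeisenbergAlg m :=
  LinearEquiv.ofInjectiveEndo (dL a).toLinearMap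
    (Function.LeftInverse.injective (g := dL (-a)) fun v ↦ dL_neg_dL a v)

/-- Every scalar product on the Lie algebra extends to a left-invariant metric. -/
theorem exists_form_eq {b : LinearMap.BilinForm ℝ (HeisenbergAlg m)} (hb : IsScalarProduct p q b) :
    ∃ g : LeftInvariantMetric (heisenbergModel m) (HeisenbergProd m) p q,
      (form g).toLinearMap₁₂ = b := by
  let β : HeisenbergAlg m →L[ℝ] HeisenbergAlg m →L[ℝ] ℝ :=
    LinearMap.toContinuousBilinearMap b
  let γ : HeisenbergAlg m → HeisenbergAlg m →L[ℝ] HeisenbergAlg m →L[ℝ] ℝ :=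
    fun a ↦ β.bilinearComp (dL (-a)) (dL (-a))
  have hγ : ∀ a x y, γ a x y = b (dL (-a) x) (dL (-a) y) := fun a x y ↦ rfl
  have hγs : ∀ a, IsScalarProduct p q (γ a).toLinearMap₁₂ := fun a ↦
    hb.comp (dLEquiv (-a)) fun x y ↦ rfl
  have hsmooth : ContDiff ℝ ∞ γ := by
    rw [contDiff_clm_apply_iff]
    intro x
    rw [contDiff_clm_apply_iff]
    intro y
    have : (fun a ↦ γ a x y) = fun a ↦ β (dL (-a) x) (dL (-a) y) := rfl
    rw [this]
    simp only [dL_apply, symp]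
    fun_prop
  refine ⟨⟨fun a ↦ γ (coords a), fun a ↦ (hγs (coords a)).symm, fun a ↦ (hγs (coords a)).eq_zero,
    fun a ↦ (hγs (coords a)).sigPos_eq, fun a ↦ (hγs (coords a)).sigNeg_eq,
    contMDiff_bilin_section hsmooth, fun c a x y ↦ ?_⟩, ?_⟩
  · rw [mfderiv_mul_left]
    refine (hγ _ _ _).trans ?_
    exact congrArg₂ (fun u v : HeisenbergAlg m ↦ b u v) (dL_neg_mul_dL c a x) (dL_neg_mul_dL c a y)
  · refine LinearMap.ext₂ fun x y ↦ ?_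
    show b (dL (-0) x) (dL (-0) y) = b x y
    rw [neg_zero, dL_zero, dL_zero]

/-! ### Automorphisms of `H₃ × ℝ^m` -/

theorem coords_mul_eq_iff (a b : HeisenbergProd m) :
    a * b = b * a ↔ symp (coords a) (coords b) = 0 := by
  have h : a * b = b * a ↔ coords (a * b) = coords (b * a) := Iff.rfl
  have h' : symp (coords b) (coords a) = -symp (coords a) (coords b) := by
    simp only [symp]
    ring
  rw [h, coords_mul, coords_mul, add_comm (coords b), h', add_right_inj, ← sub_eq_zero, ← sub_smul,
    smul_eq_zero_iff_left ez_ne_zero]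
  constructor <;> intro h <;> linarith

theorem mem_center_iff (a : HeisenbergProd m) : coords a ∈ center m ↔ ∀ b, a * b = b * a := by
  simp only [coords_mul_eq_iff, mem_center]
  constructor
  · rintro ⟨h1, h2⟩ b
    rw [symp, h1, h2]
    ring
  · intro h
    have h1 : X m (coords a) * 1 - Y m (coords a) * 0 = 0 := h (exp ((0, 1, 0), 0))
    have h2 : X m (coords a) * 0 - Y m (coords a) * 1 = 0 := h (exp ((1, 0, 0), 0))
    constructor <;> linarith

/-- Commutators of the group lie in the derived algebra; there are no higher terms, as the group is
two-step nilpotent. -/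
theorem coords_commutator (a b : HeisenbergProd m) :
    coords (a * b * a⁻¹ * b⁻¹) = symp (coords a) (coords b) • ez m := by
  simp only [coords_mul, coords_inv, symp, map_neg, map_add, map_smul, X_ez, Y_ez, smul_eq_mul]
  module

/-- Automorphisms preserve the commutators, which are exactly the elements of the derived
algebra. -/
theorem coords_map_mem_derived (φ : HeisenbergProd m ≃* HeisenbergProd m) {v : HeisenbergAlg m}
    (hv : v ∈ derived m) : coords (φ (exp v)) ∈ derived m := by
  obtain ⟨t, rfl⟩ := Submodule.mem_span_singleton.1 hv
  have h := coords_commutator (m := m) (exp ((t, 0, 0), 0)) (exp ((0, 1, 0), 0))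
  have h' : symp (m := m) ((t, 0, 0), 0) ((0, 1, 0), 0) = t := by
    show t * 1 - 0 * 0 = t
    ring
  rw [coords_exp, coords_exp, h'] at h
  rw [← h, exp_coords]
  simp only [map_mul, map_inv]
  rw [coords_commutator]
  exact Submodule.smul_mem _ _ (Submodule.mem_span_singleton_self _)

theorem coords_map_mem_center (φ : HeisenbergProd m ≃* HeisenbergProd m) {v : HeisenbergAlg m}
    (hv : v ∈ center m) : coords (φ (exp v)) ∈ center m := by
  rw [mem_center_iff]
  intro b
  have := (mem_center_iff (exp v)).1 hv (φ.symm b)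
  simpa using congrArg φ this

/-- The differential of a map preserving a subspace preserves this subspace. -/
theorem fderiv_zero_apply_mem {E : Type*} [NormedAddCommGroup E] [NormedSpace ℝ E]
    [FiniteDimensional ℝ E] {f : E → E} (hf : DifferentiableAt ℝ f 0) {U : Submodule ℝ E}
    (hU : ∀ v ∈ U, f v ∈ U) {v : E} (hv : v ∈ U) : fderiv ℝ f 0 v ∈ U := by
  have h : HasDerivAt (fun t : ℝ ↦ f (t • v)) (fderiv ℝ f 0 v) 0 := by
    have h1 : HasDerivAt (fun t : ℝ ↦ t • v) v 0 := by
      simpa using (hasDerivAt_id (0 : ℝ)).smul_const v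
    have h2 : HasFDerivAt f (fderiv ℝ f 0) ((0 : ℝ) • v) := by
      rw [zero_smul]
      exact hf.hasFDerivAt
    exact h2.comp_hasDerivAt 0 h1
  have h1 := range_deriv_subset_closure_span_image (𝕜 := ℝ) (fun t : ℝ ↦ f (t • v)) dense_univ
    ⟨0, h.deriv⟩
  refine closure_minimal ?_ U.closed_of_finiteDimensional h1
  refine Submodule.span_le.2 ?_
  rintro _ ⟨t, -, rfl⟩
  exact hU _ (U.smul_mem t hv)

/-- The differential at the identity of an automorphism preserves center and derived algebra;
multiplied by `√c`, it also absorbs the scaling factor `c`. -/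
theorem exists_linearEquiv_of_equivalent
    {g₁ g₂ : LeftInvariantMetric (heisenbergModel m) (HeisenbergProd m) p q}
    (h : g₁.Equivalent g₂) : ∃ B : HeisenbergAlg m ≃ₗ[ℝ] HeisenbergAlg m,
      (∀ x ∈ derived m, B x ∈ derived m) ∧ (∀ x ∈ center m, B x ∈ center m) ∧
      ∀ x y, form g₁ x y = form g₂ (B x) (B y) := by
  obtain ⟨c, hc, φ, hφ, hφ', h⟩ := h
  let f : HeisenbergAlg m → HeisenbergAlg m := fun v ↦ coords (φ (exp v))
  let f' : HeisenbergAlg m → HeisenbergAlg m := fun v ↦ coords (φ.symm (exp v))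
  have hf : Differentiable ℝ f := ((contMDiff_iff φ).1 hφ).differentiable (by simp)
  have hf' : Differentiable ℝ f' := ((contMDiff_iff φ.symm).1 hφ').differentiable (by simp)
  have hf0 : f 0 = 0 := congrArg coords (map_one φ)
  have hinv : ∀ v, fderiv ℝ f' 0 (fderiv ℝ f 0 v) = v := by
    intro v
    have h1 : f' ∘ f = id := funext fun v ↦ congrArg coords (φ.symm_apply_apply (exp v))
    have h2 := fderiv_comp (𝕜 := ℝ) 0 (hf' (f 0)) (hf 0)
    rw [h1, fderiv_id, hf0] at h2
    exact (congrArg (fun L : HeisenbergAlg m →L[ℝ] HeisenbergAlg m ↦ L v) h2).symm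
  have hs := Real.mul_self_sqrt hc.le
  have hs0 : √c ≠ 0 := (Real.sqrt_pos.2 hc).ne'
  have hinj : Function.Injective (√c • fderiv ℝ f 0).toLinearMap := by
    intro v w hvw
    have := smul_right_injective _ hs0 hvw
    rw [← hinv v, ← hinv w]
    exact congrArg _ this
  have hB : ∀ x, LinearEquiv.ofInjectiveEndo (√c • fderiv ℝ f 0).toLinearMap hinj x =
      √c • fderiv ℝ f 0 x := fun x ↦ rfl
  refine ⟨LinearEquiv.ofInjectiveEndo (√c • fderiv ℝ f 0).toLinearMap hinj, fun x hx ↦ ?_,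
    fun x hx ↦ ?_, fun x y ↦ ?_⟩
  · rw [hB]
    exact Submodule.smul_mem _ _
      (fderiv_zero_apply_mem (hf 0) (fun v hv ↦ coords_map_mem_derived φ hv) hx)
  · rw [hB]
    exact Submodule.smul_mem _ _
      (fderiv_zero_apply_mem (hf 0) (fun v hv ↦ coords_map_mem_center φ hv) hx)
  · have h1 := h 1 x y
    rw [mfderiv_eq] at h1
    have aux : ∀ (b : HeisenbergProd m), b = 1 → ∀ u v : HeisenbergAlg m,
        g₂.inner b u v = form g₂ u v := by
      rintro b rfl u v
      rfl
    refine h1.trans ?_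
    rw [hB, hB]
    simp only [map_smul, smul_apply, smul_eq_mul]
    rw [← mul_assoc, hs]
    exact congrArg _ (aux _ (map_one φ) _ _)

/-- A linear automorphism preserving the center acts on the quotient by it, and multiplies the
alternating form `symp` by its determinant there. -/
theorem exists_symp_map_eq (B : HeisenbergAlg m ≃ₗ[ℝ] HeisenbergAlg m)
    (hZ : ∀ x ∈ center m, B x ∈ center m) :
    ∃ δ : ℝ, δ ≠ 0 ∧ ∀ a b, symp (B a) (B b) = δ * symp a b := by
  have h : ∀ a b, symp (B a) (B b) = symp (B ((1, 0, 0), 0)) (B ((0, 1, 0), 0)) * symp a b := by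
    have h1 : ∀ a, X m (B a) = X m a * X m (B ((1, 0, 0), 0)) + Y m a * X m (B ((0, 1, 0), 0)) ∧
        Y m (B a) = X m a * Y m (B ((1, 0, 0), 0)) + Y m a * Y m (B ((0, 1, 0), 0)) := by
      intro a
      have h2 : a - X m a • ((1, 0, 0), 0) - Y m a • ((0, 1, 0), 0) ∈ center m := by
        rw [mem_center]
        simp [X, Y]
      have h3 := mem_center.1 (hZ _ h2)
      simp only [map_sub, map_smul, smul_eq_mul] at h3
      constructor <;> linarith
    intro a b
    simp only [symp, (h1 a).1, (h1 a).2, (h1 b).1, (h1 b).2]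
    ring
  refine ⟨_, fun h0 ↦ ?_, h⟩
  have h1 := h (B.symm ((1, 0, 0), 0)) (B.symm ((0, 1, 0), 0))
  rw [h0, zero_mul, B.apply_symm_apply, B.apply_symm_apply] at h1
  have h2 : symp (m := m) ((1, 0, 0), 0) ((0, 1, 0), 0) = 1 * 1 - 0 * 0 := rfl
  rw [h2] at h1
  norm_num at h1

/-- A linear automorphism preserving center and derived algebra becomes a Lie algebra automorphism
after a suitable scaling: the scaling by `r` multiplies its action on the derived algebra by `r` and
the determinant of its action modulo the center by `r ^ 2`. -/
theorem equivalent_of_linearEquiv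
    {g₁ g₂ : LeftInvariantMetric (heisenbergModel m) (HeisenbergProd m) p q}
    (B : HeisenbergAlg m ≃ₗ[ℝ] HeisenbergAlg m) (hD : ∀ x ∈ derived m, B x ∈ derived m)
    (hZ : ∀ x ∈ center m, B x ∈ center m) (hB : ∀ x y, form g₁ x y = form g₂ (B x) (B y)) :
    g₁.Equivalent g₂ := by
  obtain ⟨δ, hδ, hδB⟩ := exists_symp_map_eq B hZ
  obtain ⟨d, hd⟩ := Submodule.mem_span_singleton.1 (hD _ (Submodule.mem_span_singleton_self (ez m)))
  have hd0 : d ≠ 0 := by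
    rintro rfl
    rw [zero_smul] at hd
    exact ez_ne_zero (B.map_eq_zero_iff.1 hd.symm)
  have hr : d / δ ≠ 0 := div_ne_zero hd0 hδ
  let A : HeisenbergAlg m ≃ₗ[ℝ] HeisenbergAlg m := B ≪≫ₗ LinearEquiv.smulOfNeZero ℝ _ (d / δ) hr
  have hA : ∀ v, A v = (d / δ) • B v := fun v ↦ rfl
  have hAs : ∀ a b, symp (A a) (A b) • ez m = symp a b • A (ez m) := by
    intro a b
    have : symp (A a) (A b) = (d / δ) * (d / δ) * symp (B a) (B b) := by
      simp only [hA, symp, map_smul, smul_eq_mul]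
      ring
    rw [this, hδB, hA, ← hd, smul_smul, smul_smul]
    congr 1
    field_simp
  have hAdL : ∀ a x, dL (A a) (A x) = A (dL a x) := by
    intro a x
    rw [dL_apply, dL_apply, map_add, map_smul, div_eq_inv_mul, mul_smul, hAs, smul_smul,
      ← div_eq_inv_mul]
  let φ : HeisenbergProd m ≃* HeisenbergProd m :=
    { toFun := fun a ↦ exp (A (coords a))
      invFun := fun a ↦ exp (A.symm (coords a))
      left_inv := fun a ↦ congrArg exp (A.symm_apply_apply (coords a))
      right_inv := fun a ↦ congrArg exp (A.apply_symm_apply (coords a))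
      map_mul' := fun a b ↦ by
        have h1 := hAdL (coords a) (coords b)
        rw [dL_apply, dL_apply] at h1
        show A (coords (a * b)) = coords (exp (A (coords a)) * exp (A (coords b)))
        rw [coords_mul, coords_mul, add_assoc, map_add, ← h1, ← add_assoc]
        rfl }
  have hφ : (fun v ↦ coords (φ (exp v))) = A.toContinuousLinearEquiv := rfl
  have hφ' : (fun v ↦ coords (φ.symm (exp v))) = A.toContinuousLinearEquiv.symm := rfl
  refine ⟨((d / δ) * (d / δ))⁻¹, inv_pos.2 (mul_self_pos.2 hr), φ, ?_, ?_, fun a x y ↦ ?_⟩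
  · rw [contMDiff_iff, hφ]
    exact A.toContinuousLinearEquiv.contDiff
  · rw [contMDiff_iff, hφ']
    exact A.toContinuousLinearEquiv.symm.contDiff
  · have h1 : ∀ v : HeisenbergAlg m,
        mfderiv (heisenbergModel m) (heisenbergModel m) φ a v = A v := by
      intro v
      rw [mfderiv_eq, hφ, ContinuousLinearEquiv.fderiv]
      rfl
    have h2 : ∀ v, dL (-coords (φ a)) (A v) = A (dL (-coords a) v) := fun v ↦ by
      rw [← hAdL, map_neg]
      rfl
    have h3 : g₂.inner (φ a) (mfderiv (heisenbergModel m) (heisenbergModel m) φ a x)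
        (mfderiv (heisenbergModel m) (heisenbergModel m) φ a y) =
        form g₂ (A (dL (-coords a) x)) (A (dL (-coords a) y)) := by
      refine (congrArg₂ (fun u v : HeisenbergAlg m ↦ g₂.inner (φ a) u v) (h1 x) (h1 y)).trans ?_
      refine (inner_eq g₂ (φ a) (A x) (A y)).trans ?_
      exact congrArg₂ (fun u v ↦ form g₂ u v) (h2 x) (h2 y)
    have h4 : ∀ u v, form g₁ u v = ((d / δ) * (d / δ))⁻¹ * form g₂ (A u) (A v) := by
      intro u v
      rw [hB, hA, hA]
      simp only [map_smul, smul_apply, smul_eq_mul]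
      field_simp
    rw [h3]
    exact (inner_eq g₁ a x y).trans (h4 _ _)

end HeisenbergAlg

/-! ### Counting the classes -/

/-- A relation `R` between the elements of a type and the admissible values of an invariant counts
the classes of `s` if every element has a value, the values separate exactly the classes, and every
admissible value occurs. -/
theorem Nat.card_quotient_eq_of_complete_invariant {α T : Type*} (s : Setoid α) (S : T → Prop)
    (R : α → T → Prop) (h₁ : ∀ a, ∃ t, S t ∧ R a t)
    (h₂ : ∀ a b t, S t → R a t → R b t → s a b)
    (h₃ : ∀ a b t t', S t → S t' → R a t → R b t' → s a b → t = t')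
    (h₄ : ∀ t, S t → ∃ a, R a t) : Nat.card (Quotient s) = Nat.card {t // S t} := by
  choose f hf hf' using h₁
  refine Nat.card_congr (Equiv.ofBijective (Quotient.lift (fun a ↦ (⟨f a, hf a⟩ : {t // S t}))
    fun a b h ↦ Subtype.ext (h₃ a b _ _ (hf a) (hf b) (hf' a) (hf' b) h)) ⟨?_, ?_⟩)
  · rintro ⟨a⟩ ⟨b⟩ h
    have h : f a = f b := congrArg Subtype.val h
    exact Quotient.sound (h₂ a b _ (hf a) (hf' a) (h ▸ hf' b))
  · rintro ⟨t, ht⟩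
    obtain ⟨a, ha⟩ := h₄ t ht
    exact ⟨⟦a⟧, Subtype.ext (h₃ a a _ _ (hf a) ht (hf' a) ha (s.refl a))⟩

open HeisenbergAlg in
theorem numLeftInvariantMetrics_eq_card {p q : ℕ} (hpq : 3 ≤ p + q) :
    numLeftInvariantMetrics p q = Fintype.card {t : FlagType // t.IsAdmissible p q} := by
  have hm : p + q - 3 + 3 = p + q := by omega
  have hV := (finrank_eq (m := p + q - 3)).trans hm
  rw [← Nat.card_eq_fintype_card]
  refine Nat.card_quotient_eq_of_complete_invariant _ _
    (fun g t ↦ HasFlagType (form g).toLinearMap₁₂ (derived _) (center _) t) (fun g ↦ ?_)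
    (fun g g' t _ h h' ↦ ?_) (fun g g' t t' ht ht' h h' hg ↦ ?_) fun t ht ↦ ?_
  · exact exists_hasFlagType (isScalarProduct_form hm g) finrank_derived finrank_center
      derived_le_center
  · obtain ⟨B, h1, h2, h3⟩ := exists_flag_isometry (isScalarProduct_form hm g)
      (isScalarProduct_form hm g') finrank_derived finrank_center h h'
    exact equivalent_of_linearEquiv B h1 h2 h3
  · obtain ⟨B, h1, h2, h3⟩ := exists_linearEquiv_of_equivalent hg
    have h'' : HasFlagType (form g').toLinearMap₁₂ (derived _) (center _) t :=
      h.map B h3 h1 fun y hy ↦ exists_mem_apply_eq_of_finrank_eq B h2 rfl hy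
    exact h''.unique (isScalarProduct_form hm g') finrank_derived finrank_center h' ht ht'
  · obtain ⟨b, hb, hbt⟩ := exists_isScalarProduct_hasFlagType hV finrank_derived finrank_center
      derived_le_center ht
    obtain ⟨g, rfl⟩ := exists_form_eq hb
    exact ⟨g, hbt⟩

theorem card_isAdmissible_eq {p q p' q' : ℕ} (hp : min p 3 = p') (hq : min q 3 = q') :
    Fintype.card {t : FlagType // t.IsAdmissible p q} =
      Fintype.card {t : FlagType // t.IsAdmissible p' q'} := by
  subst hp hq
  exact Fintype.card_congr (Equiv.subtypeEquivRight fun t ↦ (t.isAdmissible_min_three p q).symm)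

theorem theorem1p2 (p q : ℕ) (hp : 1 ≤ p) (hq : 1 ≤ q) (hpq : 4 ≤ p + q) :
    (3 ≤ p → 3 ≤ q → numLeftInvariantMetrics p q = 21) ∧
    (3 ≤ p → q = 2 → numLeftInvariantMetrics p q = 15) ∧
    (3 ≤ p → q = 1 → numLeftInvariantMetrics p q = 6) ∧
    (p = 2 → q = 2 → numLeftInvariantMetrics p q = 10) := by
  rw [numLeftInvariantMetrics_eq_card (by omega)]
  refine ⟨fun h h' ↦ ?_, fun h h' ↦ ?_, fun h h' ↦ ?_, fun h h' ↦ ?_⟩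
  · rw [card_isAdmissible_eq (p' := 3) (q' := 3) (by omega) (by omega)]
    decide +kernel
  · rw [card_isAdmissible_eq (p' := 3) (q' := 2) (by omega) (by omega)]
    decide +kernel
  · rw [card_isAdmissible_eq (p' := 3) (q' := 1) (by omega) (by omega)]
    decide +kernel
  · rw [card_isAdmissible_eq (p' := 2) (q' := 2) (by omega) (by omega)]
    decide +kernel
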